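/- **Setting.** Let $T>0$, let $J=\begin{pmatrix}0&1\\-1&0\end{pmatrix}$, and let $H\colon\mathbb R\times\mathbb R^2\to\mathbb R$, $(t,z)\mapsto H(t,z)$, be continuous, $T$-periodic in $t$ and continuously differentiable in $z$, with $D_zH(t,\cdot)$ Lipschitz continuous uniformly in $t$. Consider the planar Hamiltonian system $\dot z=JD_zH(t,z)$. *Displacement.* Let $\Pi(\phi,r)=(r\cos\phi,-r\sin\phi)$ be the clockwise polar coordinates on $\mathbb R^2\setminus\{0\}$. If the solution with $z(0)=\Pi(\phi,r)$, $r>0$, does not meet the origin for $t\in[0,T]$, it lifts to a unique continuous path $t\mapsto p(t)\in\mathbb R\times(0,\infty)$ with $p(0)=(\phi,r)$ and $\Pi(p(t))=z(t)$; put $\mathcal F(\phi,r)=(\mathcal F_1,\mathcal F_2)(\phi,r)=p(T)-(\phi,r)$. *Degree.* Let $f$ be an $\mathbb R^2$-valued function of $(\phi,r)$, and let $r>0$ be such that $f(\cdot,r)$ is continuous, $2\pi$-periodic and without zeros. Then $\mathfrak D(f,r)$ is the Brouwer degree at $0$, on the open disc of radius $r$ about $0$, of the map $\tilde f\circ\Pi^{-1}$,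 where $\tilde f\colon\mathbb R\times[0,\infty)\to\mathbb R^2$ is any continuous map, $2\pi$-periodic in the first variable, with $\tilde f(\cdot,0)\equiv0$ and $\tilde f(\cdot,r)=f(\cdot,r)$ (it does not depend on the choice of $\tilde f$). *Maslov index.* For a continuous $L\colon[0,T]\to\mathbb R^{2\times2}$ with symmetric values let $\Psi_L$ be the fundamental matrix of $\dot z=JL(t)z$, $\Psi_L(0)=I$. The matrix $L$ is $T$-nonresonant if $\det(I-\Psi_L(T))\neq0$. In this case prolong $\Psi_L$ continuously, through symplectic matrices $M$ with $\det(I-M)\ne0$, to a path $\hat\Psi$ that ends at $-I$ if $\det(I-\Psi_L(T))>0$, and at $\begin{pmatrix}2&0\\0&1/2\end{pmatrix}$ if $\det(I-\Psi_L(T))<0$. Write $\hat\Psi(s)=P(s)R(\theta(s))$ with $P(s)$ symmetric positive definite and symplectic, $R(\theta)=\begin{pmatrix}\cos\theta&\sin\theta\\-\sin\theta&\cos\theta\end{pmatrix}$, and $\theta$ continuous with $\theta(0)=0$. The $T$-Maslov index of $L$ is the integer $i_T(\Psi_L)=-\theta_{\mathrm{end}}/\pi$, where $\theta_{\mathrm{end}}$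 is the value of $\theta$ at the end of the prolonged path (it counts counter-clockwise half-windings and does not depend on the prolongation). **Lemma (at zero).** Suppose that for every $t\in[0,T]$ the function $H(t,\cdot)$ is twice differentiable at $z=0$ with $D_zH(t,0)=0$ and $D_{zz}H(t,0)=\mathbb A(t)$, where $\mathbb A\in C([0,T],\mathbb R^{2\times2})$ is $T$-nonresonant with Maslov index $i_0=i_T(\Psi_{\mathbb A})$. Then there is $r_0>0$ such that for every $0<r<r_0$ the value $\mathcal F(\phi,r)$ is defined for all $\phi\in\mathbb R$, and for all $\phi\in\mathbb R$ $$2\ell\pi<-\mathcal F_1(\phi,r)<2(\ell+1)\pi\quad\text{if } i_0=2\ell+1,\ \ell\in\mathbb Z,$$ $$(2\ell-1)\pi<-\mathcal F_1(\phi,r)<(2\ell+1)\pi\quad\text{if } i_0=2\ell,\ \ell\in\mathbb Z,$$ and moreover, for every $M\in\mathbb Z$, $\mathcal F(\cdot,r)+(2M\pi,0)$ has no zeros and $$\mathfrak D\bigl(\mathcal F+(2M\pi,0),r\bigr)=\begin{cases}-2&\text{if } i_0=2M,\\ 0&\text{if } i_0\neq2M.\end{cases}$$ **Lemma (at infinity).**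 Suppose that there is $\mathbb B\in C([0,T],\mathbb R^{2\times2})$ with $\lim_{\|z\|\to\infty}\|D_zH(t,z)-\mathbb B(t)z\|/\|z\|=0$ uniformly in $t\in[0,T]$ (so that $\mathbb B$ has symmetric values), and that $\mathbb B$ is $T$-nonresonant with Maslov index $i_\infty=i_T(\Psi_{\mathbb B})$. Then there is $r_\infty>0$ such that all the conclusions of the previous lemma hold for every $r>r_\infty$, with $i_\infty$ in place of $i_0$. -/

import Mathlib

open scoped NNReal
open Set

noncomputable section

namespace PlanarHamiltonian

/-- The Euclidean plane. -/
abbrev Plane : Type := EuclideanSpace ℝ (Fin 2)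

/-- Real `2 × 2` matrices. -/
abbrev Mat : Type := Matrix (Fin 2) (Fin 2) ℝ

/-- A matrix acting on the Euclidean plane. -/
abbrev act (M : Mat) : Plane →L[ℝ] Plane := Matrix.toEuclideanCLM (𝕜 := ℝ) M

/-- The standard symplectic matrix. -/
def J : Mat := !![0, 1; -1, 0]

/-! ### The Hamiltonian and its behaviour at zero and at infinity -/

/-- Regularity of a `T`-periodic Hamiltonian `H t z`: jointly continuous, `T`-periodic in time,
continuously differentiable in space, with space gradient Lipschitz uniformly in time. -/
structure IsRegularHamiltonian (T : ℝ) (H : ℝ → Plane → ℝ) : Prop where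
  continuous : Continuous (fun q : ℝ × Plane => H q.1 q.2)
  periodic : ∀ t z, H (t + T) z = H t z
  contDiff : ∀ t, ContDiff ℝ 1 (H t)
  lipschitz : ∃ K : ℝ≥0, ∀ t, LipschitzWith K (fun z => gradient (H t) z)

/-- Asymptotic linearity at the origin: for every `t ∈ [0, T]` the function `H t` is twice
differentiable at `0` with zero gradient and with Hessian `A t`, where `A` is continuous. -/
structure IsAsymptoticallyLinearAtZero (T : ℝ) (H : ℝ → Plane → ℝ) (A : ℝ → Mat) : Prop where
  continuousOn : ContinuousOn A (Icc 0 T)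
  gradient_zero : ∀ t ∈ Icc 0 T, gradient (H t) 0 = 0
  hessian : ∀ t ∈ Icc 0 T, HasFDerivAt (fun z => gradient (H t) z) (act (A t)) 0

/-- Asymptotic linearity at infinity: `‖∇ H t z - B t z‖ / ‖z‖ → 0` as `‖z‖ → ∞`, uniformly in
`t ∈ [0, T]`, where `B` is continuous. -/
structure IsAsymptoticallyLinearAtInfinity (T : ℝ) (H : ℝ → Plane → ℝ) (B : ℝ → Mat) : Prop where
  continuousOn : ContinuousOn B (Icc 0 T)
  tendsto : ∀ ε > 0, ∃ ρ > 0, ∀ t ∈ Icc 0 T, ∀ z : Plane, ρ < ‖z‖ →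
    ‖gradient (H t) z - act (B t) z‖ / ‖z‖ < ε

/-! ### Linear systems and the Maslov index -/

/-- `Ψ` is, on `[0, T]`, the fundamental matrix of `z' = J (L t) z`: `Ψ 0 = I` and, for each `z₀`,
the function `t ↦ Ψ t z₀` is a solution. -/
structure IsFundamentalMatrix (T : ℝ) (L : ℝ → Mat) (Ψ : ℝ → Mat) : Prop where
  init : Ψ 0 = 1
  solution : ∀ z₀ : Plane, ∀ t ∈ Icc 0 T,
    HasDerivWithinAt (fun s => act (Ψ s) z₀) (act J (act (L t) (act (Ψ t) z₀))) (Icc 0 T) t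

/-- Nonresonance: `1` is not an eigenvalue of `Ψ T`. -/
def IsNonresonant (T : ℝ) (Ψ : ℝ → Mat) : Prop := (1 - Ψ T).det ≠ 0

/-- The symplectic group of the plane. -/
def IsSymplectic (M : Mat) : Prop := M.transpose * J * M = J

/-- The clockwise rotation of angle `θ`. -/
def rot (θ : ℝ) : Mat := !![Real.cos θ, Real.sin θ; -Real.sin θ, Real.cos θ]

/-- The hyperbolic rotations: for `0 ≤ τ` these are all the positive definite symmetric symplectic
matrices. -/
def hyp (τ σ : ℝ) : Mat :=
  !![Real.cosh τ + Real.sinh τ * Real.cos σ, Real.sinh τ * Real.sin σ;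
     Real.sinh τ * Real.sin σ, Real.cosh τ - Real.sinh τ * Real.cos σ]

/-- `θ` is, on `[0, S]`, the continuous clockwise angle with `θ 0 = 0` of the symplectic path `Ψ`,
in the decomposition `Ψ s = hyp τ σ * rot (θ s)`. (Here `τ` and `σ` depend on `s`; the factor
`hyp τ σ` is determined by `Ψ s`, and `θ` by `Ψ`.) -/
structure IsRotationAngle (S : ℝ) (Ψ : ℝ → Mat) (θ : ℝ → ℝ) : Prop where
  continuousOn : ContinuousOn θ (Icc 0 S)
  init : θ 0 = 0
  decomp : ∀ s ∈ Icc 0 S, ∃ τ σ : ℝ, 0 ≤ τ ∧ Ψ s = hyp τ σ * rot (θ s)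

/-- The nonresonant symplectic path `Ψ` on `[0, T]` has `T`-Maslov index `i`: it is prolonged on
`[T, T + 1]`, through symplectic matrices `M` with `det (I - M) ≠ 0`, up to `-I` if
`det (I - Ψ T) > 0` and up to `diag (2, 1/2)` if `det (I - Ψ T) < 0`, and the prolonged path makes
`i` counter-clockwise half-windings. -/
def HasMaslovIndex (T : ℝ) (Ψ : ℝ → Mat) (i : ℤ) : Prop :=
  IsNonresonant T Ψ ∧
  ∃ (Ψ' : ℝ → Mat) (θ : ℝ → ℝ),
    EqOn Ψ' Ψ (Icc 0 T) ∧
    ContinuousOn Ψ' (Icc 0 (T + 1)) ∧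
    (∀ s ∈ Icc 0 (T + 1), IsSymplectic (Ψ' s)) ∧
    (∀ s ∈ Icc T (T + 1), (1 - Ψ' s).det ≠ 0) ∧
    (0 < (1 - Ψ T).det → Ψ' (T + 1) = -1) ∧
    ((1 - Ψ T).det < 0 → Ψ' (T + 1) = !![2, 0; 0, 1 / 2]) ∧
    IsRotationAngle (T + 1) Ψ' θ ∧
    -θ (T + 1) = i * Real.pi

/-! ### Clockwise polar coordinates and the lifted Poincaré map -/

/-- Clockwise polar coordinates. -/
def polarProj (φ r : ℝ) : Plane := !₂[r * Real.cos φ, -(r * Real.sin φ)]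

/-- `p t = (angle, radius)` is, on `[0, T]`, a trajectory of the system `z' = J ∇ H t z` lifted to
clockwise polar coordinates, with starting point `(φ, r)`. -/
structure IsLiftedTrajectory (T : ℝ) (H : ℝ → Plane → ℝ) (φ r : ℝ) (p : ℝ → ℝ × ℝ) : Prop where
  init : p 0 = (φ, r)
  continuousOn : ContinuousOn p (Icc 0 T)
  pos : ∀ t ∈ Icc 0 T, 0 < (p t).2
  solution : ∀ t ∈ Icc 0 T,
    HasDerivWithinAt (fun s => polarProj (p s).1 (p s).2)
      (act J (gradient (H t) (polarProj (p t).1 (p t).2))) (Icc 0 T) t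

open Classical in
/-- The lifted Poincaré map `(φ, r) ↦ p T`, with `p` the lifted trajectory that starts at `(φ, r)`.
(If there is none, that is, if the solution meets the origin in `[0, T]`, the value is
irrelevant.) -/
def poincareLift (T : ℝ) (H : ℝ → Plane → ℝ) (φ r : ℝ) : ℝ × ℝ :=
  if h : ∃ p : ℝ → ℝ × ℝ, IsLiftedTrajectory T H φ r p then h.choose T else (φ, r)

/-- The displacement `(φ, r) ↦ P (φ, r) - (φ, r)` of the lifted Poincaré map `P`. -/
def displacement (T : ℝ) (H : ℝ → Plane → ℝ) (φ r : ℝ) : Plane :=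
  !₂[(poincareLift T H φ r).1 - φ, (poincareLift T H φ r).2 - r]

/-! ### Degree -/

/-- The Brouwer degree of `f`, on the bounded open set `U`, with respect to `y ∉ f (∂ U)`, equals
`d`: there is a `C¹` map `g` which is closer to `f` on the closure of `U` than `y` is to `f (∂ U)`,
for which `y` is a regular value, and `d` is the sum of the signs of the Jacobian determinant of
`g` at its preimages of `y` in `U`. (This sum does not depend on `g`.) -/
def HasBrouwerDegree (f : Plane → Plane) (U : Set Plane) (y : Plane) (d : ℤ) : Prop :=
  IsOpen U ∧ Bornology.IsBounded U ∧ ContinuousOn f (closure U) ∧ y ∉ f '' frontier U ∧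
  ∃ (g : Plane → Plane) (Z : Finset Plane),
    ContDiff ℝ 1 g ∧
    (∀ x ∈ closure U, ∀ w ∈ frontier U, ‖g x - f x‖ < ‖y - f w‖) ∧
    (∀ x, x ∈ Z ↔ x ∈ U ∧ g x = y) ∧
    (∀ x ∈ Z, (fderiv ℝ g x).det ≠ 0) ∧
    d = ∑ x ∈ Z, ((SignType.sign (fderiv ℝ g x).det : SignType) : ℤ)

/-- The degree `𝔇(f, r)` of a map `f` of the polar coordinates `(φ, r)` equals `d`: `f (·, r)` does
not vanish, and it is extended to a continuous map `f'` on `ℝ × [0, ∞)`, `2π`-periodic in the angle,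
that vanishes for radius `0`, for which the Brouwer degree on the disc of radius `r` of the map
`G = f' ∘ polarProj⁻¹` is `d`. (It does not depend on the extension.) -/
def HasPolarDegree (f : ℝ → ℝ → Plane) (r : ℝ) (d : ℤ) : Prop :=
  0 < r ∧ (∀ φ, f φ r ≠ 0) ∧
  ∃ (f' : ℝ → ℝ → Plane) (G : Plane → Plane),
    ContinuousOn (fun q : ℝ × ℝ => f' q.1 q.2) (univ ×ˢ Ici 0) ∧
    (∀ φ, ∀ s, 0 ≤ s → f' (φ + 2 * Real.pi) s = f' φ s) ∧
    (∀ φ, f' φ 0 = 0) ∧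
    (∀ φ, f' φ r = f φ r) ∧
    (∀ φ, ∀ s, 0 ≤ s → G (polarProj φ s) = f' φ s) ∧
    HasBrouwerDegree G (Metric.ball 0 r) 0 d

/-- The behaviour on the circle of radius `r` of the displacement `F` of the lifted Poincaré map,
for the index `i`: all solutions that start on the circle avoid the origin, the bounds for the
counter-clockwise rotation `-F₁`, and the degree of `F + (2Mπ, 0)`. -/
structure HasRotationAndDegree (T : ℝ) (H : ℝ → Plane → ℝ) (r : ℝ) (i : ℤ) : Prop where
  lift : ∀ φ, ∃ p, IsLiftedTrajectory T H φ r p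
  rotation_odd : ∀ l : ℤ, i = 2 * l + 1 → ∀ φ,
    2 * l * Real.pi < -(displacement T H φ r 0) ∧
      -(displacement T H φ r 0) < 2 * (l + 1) * Real.pi
  rotation_even : ∀ l : ℤ, i = 2 * l → ∀ φ,
    (2 * l - 1) * Real.pi < -(displacement T H φ r 0) ∧
      -(displacement T H φ r 0) < (2 * l + 1) * Real.pi
  degree : ∀ M : ℤ,
    HasPolarDegree (fun φ s => displacement T H φ s + !₂[2 * (M : ℝ) * Real.pi, 0]) r
      (if i = 2 * M then -2 else 0)

end PlanarHamiltonian

end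

/-!
A solution starting on the circle of radius `r`, divided by `r`, solves a perturbation of the linear
system, and for radii near the end in question (`0` or infinity) it stays uniformly close to the
linear solution with the same initial direction
(`IsAsymptoticallyLinearAlong.eventually_norm_sub_le`). At the origin the linearisation is only
pointwise in time, so the error in the equation is controlled through its time integral, by
dominated convergence along sequences of radii, and Grönwall's inequality is applied after
subtracting that integral. Since linear solutions stay away from the origin, closeness of the paths
gives closeness of their continuous angles, without any covering theory: if two vectors form an
acute angle, that angle is an arctangent (`polarProj_add_relAngle`). Hence the displacement is a
small perturbation of that of the linear system
(`IsAsymptoticallyLinearAlong.eventually_displacement`).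

For the linear system the decomposition `Ψ s = hyp τ σ * rot (θ s)` shows that the angle of
`Ψ s z` minus the angle of `z` differs from `θ s` by less than `π / 2`. Along the prolongation the
trace of `Ψ s` stays on one side of `2`, below it for odd and above it for even index. In the first
case there are no positive eigenvalues, so no vector turns by a multiple of `2 π`; in the second
there are no negative eigenvalues, so no vector turns by an odd multiple of `π`. The bounds known at
the end of the prolongation therefore hold at time `T` already
(`IsProlongedPath.rotation_odd`, `IsProlongedPath.rotation_even`), and by compactness they pass to
the nonlinear system.

The degree is zero whenever the first component of the translated displacement has constant sign
(`hasPolarDegree_zero`). The remaining case is `i = 2 M`, where `Ψ T` is hyperbolic with eigenvalues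
`c > 1` and `c⁻¹`. In coordinates `(a, b)` along the eigenvectors, the linear displacement
`(angle, radius)` is joined by segments avoiding the origin to the quadratic map
`(a b, a² - b²)` (`segment_quadMap_ne_zero`). This map has degree `-2`: the perturbation
`(a b, a² - b² - ε²)` has exactly two zeros, both with negative Jacobian determinant
(`hasPolarDegree_neg_two`).
-/

noncomputable section

namespace PlanarHamiltonian

open Filter Topology

/-! ### Ordinary differential equations -/

section ODE

variable {E : Type*} [NormedAddCommGroup E] [NormedSpace ℝ E]

/-- A derivative within `[a, b]` is a right derivative on `[a, b)`. -/
lemma hasDerivWithinAt_Ici_of_Icc {z : ℝ → E} {z' : E} {a b t : ℝ} (ht : t ∈ Ico a b)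
    (h : HasDerivWithinAt z z' (Icc a b) t) : HasDerivWithinAt z z' (Ici t) t := by
  have h1 : HasDerivWithinAt z z' (Icc t b) t := h.mono (Icc_subset_Icc_left ht.1)
  exact h1.mono_of_mem_nhdsWithin (Icc_mem_nhdsGE ht.2)

/-- Global existence for a globally Lipschitz field. The field is multiplied by a cutoff which is
`1` on a ball containing every solution, by Grönwall's inequality; as the truncated field is
bounded, a single application of the Picard–Lindelöf theorem covers the whole interval. -/
theorem exists_solution_of_lipschitz [CompleteSpace E] {v : ℝ → E → E} {K : ℝ≥0}
    (hK : ∀ t, LipschitzWith K (v t)) (hc : ∀ x, Continuous (fun t => v t x)) {T : ℝ}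
    (hT : 0 ≤ T) (x₀ : E) :
    ∃ z : ℝ → E, z 0 = x₀ ∧
      ∀ t ∈ Icc 0 T, HasDerivWithinAt z (v t (z t)) (Icc 0 T) t := by
  obtain ⟨b, hb⟩ : ∃ b : ℝ≥0, ∀ t ∈ Icc 0 T, ‖v t 0‖ ≤ b := by
    obtain ⟨b, hb⟩ := isCompact_Icc.exists_bound_of_continuousOn (hc 0).continuousOn (s := Icc 0 T)
    exact ⟨b.toNNReal, fun t ht => (hb t ht).trans (Real.le_coe_toNNReal b)⟩
  have hgrow : ∀ t ∈ Icc 0 T, ∀ x, ‖v t x‖ ≤ K * ‖x‖ + b := by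
    intro t ht x
    have h1 := (hK t).norm_sub_le x 0
    have h2 := norm_le_norm_sub_add (v t x) (v t 0)
    rw [sub_zero] at h1
    linarith [hb t ht]
  set ρ : ℝ := gronwallBound ‖x₀‖ K b T with hρ
  have hmono : Monotone (gronwallBound ‖x₀‖ K b) :=
    gronwallBound_mono (norm_nonneg _) b.2 K.2
  have hρ0 : 0 ≤ ρ := by
    have := hmono hT
    rw [gronwallBound_x0] at this
    exact (norm_nonneg _).trans this
  set χ : E → ℝ := fun x => max 0 (min 1 (ρ + 1 - ‖x‖)) with hχ
  have hχ0 : ∀ x, 0 ≤ χ x := fun x => le_max_left _ _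
  have hχ1 : ∀ x, χ x ≤ 1 := fun x => max_le zero_le_one (min_le_left _ _)
  have hχL : ∀ x y, |χ x - χ y| ≤ ‖x - y‖ := by
    intro x y
    have h := abs_norm_sub_norm_le x y
    rw [abs_le] at h ⊢
    simp only [hχ]
    constructor
    · rcases max_cases 0 (min 1 (ρ + 1 - ‖x‖)) with h1 | h1 <;>
      rcases max_cases 0 (min 1 (ρ + 1 - ‖y‖)) with h2 | h2 <;>
      rcases min_cases 1 (ρ + 1 - ‖x‖) with h3 | h3 <;>
      rcases min_cases 1 (ρ + 1 - ‖y‖) with h4 | h4 <;> linarith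
    · rcases max_cases 0 (min 1 (ρ + 1 - ‖x‖)) with h1 | h1 <;>
      rcases max_cases 0 (min 1 (ρ + 1 - ‖y‖)) with h2 | h2 <;>
      rcases min_cases 1 (ρ + 1 - ‖x‖) with h3 | h3 <;>
      rcases min_cases 1 (ρ + 1 - ‖y‖) with h4 | h4 <;> linarith
  have hbound : ∀ t ∈ Icc 0 T, ∀ x, ‖χ x • v t x‖ ≤ K * (ρ + 1) + b := by
    intro t ht x
    rw [norm_smul, Real.norm_of_nonneg (hχ0 x)]
    by_cases hx : ‖x‖ ≤ ρ + 1
    · have h1 : χ x * ‖v t x‖ ≤ 1 * ‖v t x‖ :=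
        mul_le_mul_of_nonneg_right (hχ1 x) (norm_nonneg _)
      have h2 : (K : ℝ) * ‖x‖ ≤ K * (ρ + 1) := mul_le_mul_of_nonneg_left hx K.2
      linarith [hgrow t ht x]
    · have : χ x = 0 := by
        simp only [hχ]
        apply max_eq_left
        exact (min_le_right _ _).trans (by linarith)
      rw [this, zero_mul]
      have := K.2
      have := b.2
      positivity
  set L : ℝ≥0 := K * (ρ.toNNReal + 1) + b with hL
  have hLc : (L : ℝ) = K * (ρ + 1) + b := by
    simp [hL, Real.coe_toNNReal ρ hρ0]
  set a : ℝ≥0 := L * T.toNNReal with ha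
  have hPL : IsPicardLindelof (fun t x => χ x • v t x) (⟨0, left_mem_Icc.2 hT⟩ : Icc (0 : ℝ) T)
      x₀ a 0 L (K + (K * (‖x₀‖₊ + a) + b)) := by
    refine ⟨fun t ht => ?_, fun x _ => ?_, fun t ht x _ => ?_, ?_⟩
    · refine LipschitzOnWith.of_dist_le_mul fun x hx y hy => ?_
      rw [dist_eq_norm, dist_eq_norm]
      have hy' : ‖y‖ ≤ ‖x₀‖ + a := by
        have := norm_le_norm_add_norm_sub x₀ y
        rw [Metric.mem_closedBall, dist_eq_norm] at hy
        rw [norm_sub_rev] at hy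
        linarith
      have hsplit : χ x • v t x - χ y • v t y
          = χ x • (v t x - v t y) + (χ x - χ y) • v t y := by
        rw [smul_sub, sub_smul]; abel
      rw [hsplit]
      refine (norm_add_le _ _).trans ?_
      rw [norm_smul, norm_smul, Real.norm_of_nonneg (hχ0 x), Real.norm_eq_abs]
      have h1 : χ x * ‖v t x - v t y‖ ≤ 1 * (K * ‖x - y‖) :=
        mul_le_mul (hχ1 x) ((hK t).norm_sub_le x y) (norm_nonneg _) zero_le_one
      have h2 : |χ x - χ y| * ‖v t y‖ ≤ ‖x - y‖ * (K * (‖x₀‖ + a) + b) := by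
        refine mul_le_mul (hχL x y) ((hgrow t ht y).trans ?_) (norm_nonneg _) (norm_nonneg _)
        exact add_le_add_left (mul_le_mul_of_nonneg_left hy' K.2) _
      push_cast
      linarith
    · exact ((hc x).const_smul _).continuousOn
    · rw [hLc]
      exact hbound t ht x
    · simp only [sub_zero, NNReal.coe_zero, sub_self]
      rw [max_eq_left hT, ha, NNReal.coe_mul, Real.coe_toNNReal T hT]
  obtain ⟨z, hz0, hz⟩ := hPL.exists_eq_forall_mem_Icc_hasDerivWithinAt₀
  have hzc : ContinuousOn z (Icc 0 T) := fun t ht => (hz t ht).continuousWithinAt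
  have hzb : ∀ t ∈ Icc 0 T, ‖z t‖ ≤ ρ := by
    intro t ht
    have h := norm_le_gronwallBound_of_norm_deriv_right_le (K := (K : ℝ)) (ε := (b : ℝ)) hzc
      (fun s hs => hasDerivWithinAt_Ici_of_Icc hs (hz s (Ico_subset_Icc_self hs)))
      (show ‖z 0‖ ≤ ‖x₀‖ by rw [← hz0]) (fun s hs => by
        have hs' := Ico_subset_Icc_self hs
        rw [norm_smul, Real.norm_of_nonneg (hχ0 _)]
        have h1 : χ (z s) * ‖v s (z s)‖ ≤ 1 * ‖v s (z s)‖ :=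
          mul_le_mul_of_nonneg_right (hχ1 _) (norm_nonneg _)
        linarith [hgrow s hs' (z s)]) t ht
    rw [sub_zero] at h
    exact h.trans (hmono ht.2)
  refine ⟨z, hz0, fun t ht => ?_⟩
  have h1 : χ (z t) = 1 := by
    simp only [hχ]
    rw [min_eq_left (by linarith [hzb t ht])]
    exact max_eq_right zero_le_one
  have h2 := hz t ht
  simp only [h1, one_smul] at h2
  exact h2

/-- Lipschitz dependence on the initial value for a globally Lipschitz field; for equal initial
values this is uniqueness. -/
lemma dist_solution_le {v : ℝ → E → E} {K : ℝ≥0}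
    (hK : ∀ t, LipschitzWith K (v t)) {T : ℝ} {z w : ℝ → E}
    (hz : ∀ t ∈ Icc 0 T, HasDerivWithinAt z (v t (z t)) (Icc 0 T) t)
    (hw : ∀ t ∈ Icc 0 T, HasDerivWithinAt w (v t (w t)) (Icc 0 T) t) {t : ℝ}
    (ht : t ∈ Icc 0 T) : dist (z t) (w t) ≤ dist (z 0) (w 0) * Real.exp (K * t) := by
  have h := dist_le_of_trajectories_ODE hK (fun t ht => (hz t ht).continuousWithinAt)
    (fun s hs => hasDerivWithinAt_Ici_of_Icc hs (hz s (Ico_subset_Icc_self hs)))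
    (fun t ht => (hw t ht).continuousWithinAt)
    (fun s hs => hasDerivWithinAt_Ici_of_Icc hs (hw s (Ico_subset_Icc_self hs))) le_rfl t ht
  rwa [sub_zero] at h

/-- Grönwall's inequality with a small integral of the error: if `y' = B y + e`, `y 0 = 0`,
`‖B‖ ≤ β` and the integral `P` of `e` is at most `δ`, then `‖y - P‖` is bounded by the Grönwall
bound with the constant error `β δ`, because `(y - P)' = B (y - P) + B P`. -/
lemma norm_le_of_primitive_le {T β δ : ℝ} (hβ : 0 ≤ β) (hδ : 0 ≤ δ) {B : ℝ → E →L[ℝ] E}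
    (hB : ∀ t ∈ Icc 0 T, ‖B t‖ ≤ β) {y e P : ℝ → E}
    (hy : ∀ t ∈ Icc 0 T, HasDerivWithinAt y (B t (y t) + e t) (Icc 0 T) t) (hy0 : y 0 = 0)
    (hP : ∀ t ∈ Icc 0 T, HasDerivWithinAt P (e t) (Icc 0 T) t) (hP0 : P 0 = 0)
    (hPδ : ∀ t ∈ Icc 0 T, ‖P t‖ ≤ δ) {t : ℝ} (ht : t ∈ Icc 0 T) :
    ‖y t‖ ≤ δ + gronwallBound 0 β (β * δ) T := by
  have hd : ∀ t ∈ Icc 0 T, HasDerivWithinAt (fun s => y s - P s) (B t (y t)) (Icc 0 T) t := by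
    intro t ht
    have := (hy t ht).sub (hP t ht)
    rwa [add_sub_cancel_right] at this
  have h := norm_le_gronwallBound_of_norm_deriv_right_le (δ := 0) (K := β) (ε := β * δ)
    (fun t ht => (hd t ht).continuousWithinAt)
    (fun s hs => hasDerivWithinAt_Ici_of_Icc hs (hd s (Ico_subset_Icc_self hs)))
    (by simp [hy0, hP0]) (fun s hs => by
      have hs' := Ico_subset_Icc_self hs
      have h1 : B s (y s) = B s (y s - P s) + B s (P s) := by rw [← map_add, sub_add_cancel]
      rw [h1]
      refine (norm_add_le _ _).trans (add_le_add ?_ ?_)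
      · exact (B s).le_of_opNorm_le (hB s hs') _
      · exact ((B s).le_of_opNorm_le (hB s hs') _).trans
          (mul_le_mul_of_nonneg_left (hPδ s hs') hβ)) t ht
  rw [sub_zero] at h
  have h2 := gronwallBound_mono le_rfl (mul_nonneg hβ hδ) hβ ht.2 (δ := 0)
  have h3 := norm_le_norm_sub_add (y t) (P t)
  linarith [hPδ t ht]

end ODE

/-! ### The gradient of a regular Hamiltonian -/

/-- A `C¹` function with a Lipschitz gradient differs from its linearisation quadratically. -/
lemma abs_sub_sub_inner_gradient_le {h : Plane → ℝ} (hh : ContDiff ℝ 1 h) {K : ℝ≥0}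
    (hK : LipschitzWith K (fun z => gradient h z)) (z v : Plane) :
    |h (z + v) - h z - inner ℝ (gradient h z) v| ≤ K * ‖v‖ * ‖v‖ := by
  have hd : ∀ x, HasFDerivAt h (fderiv ℝ h x) x := fun x =>
    (hh.differentiable one_ne_zero x).hasFDerivAt
  have hb : ∀ x ∈ Metric.closedBall z ‖v‖, ‖fderiv ℝ h x - fderiv ℝ h z‖ ≤ K * ‖v‖ := by
    intro x hx
    have h1 := hK.dist_le_mul x z
    rw [dist_eq_norm] at h1
    simp only [gradient] at h1
    rw [← map_sub, LinearIsometryEquiv.norm_map] at h1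
    exact h1.trans (mul_le_mul_of_nonneg_left (Metric.mem_closedBall.1 hx) K.2)
  have h2 := (convex_closedBall z ‖v‖).norm_image_sub_le_of_norm_hasFDerivWithin_le'
    (fun x _ => (hd x).hasFDerivWithinAt) hb (Metric.mem_closedBall_self (norm_nonneg v))
    (show z + v ∈ Metric.closedBall z ‖v‖ by simp)
  rw [add_sub_cancel_left, Real.norm_eq_abs] at h2
  have h3 : inner ℝ (gradient h z) v = fderiv ℝ h z v := by
    simp [gradient]
  rw [h3]
  exact h2

/-- The gradient is continuous in time, as the limit of difference quotients, uniform in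
time because the Lipschitz constant is. -/
lemma IsRegularHamiltonian.continuous_gradient_time {T : ℝ} {H : ℝ → Plane → ℝ}
    (hH : IsRegularHamiltonian T H) (z : Plane) : Continuous (fun t => gradient (H t) z) := by
  obtain ⟨K, hK⟩ := hH.lipschitz
  have key : ∀ v : Plane, Continuous (fun t => inner ℝ (gradient (H t) z) v) := by
    intro v
    have hu : TendstoUniformly
        (fun (n : ℕ) t => ((n : ℝ) + 1) * (H t (z + ((n : ℝ) + 1)⁻¹ • v) - H t z))
        (fun t => inner ℝ (gradient (H t) z) v) atTop := by
      rw [Metric.tendstoUniformly_iff]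
      intro ε hε
      have hlim : Tendsto (fun n : ℕ => (K * ‖v‖ * ‖v‖) * (1 / ((n : ℝ) + 1))) atTop (𝓝 0) := by
        have := (tendsto_one_div_add_atTop_nhds_zero_nat (𝕜 := ℝ)).const_mul (K * ‖v‖ * ‖v‖)
        rwa [mul_zero] at this
      filter_upwards [hlim.eventually (gt_mem_nhds hε)] with n hn t
      refine lt_of_le_of_lt ?_ hn
      have hn0 : (0 : ℝ) < (n : ℝ) + 1 := by positivity
      have h := abs_sub_sub_inner_gradient_le (hH.contDiff t) (hK t) z (((n : ℝ) + 1)⁻¹ • v)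
      rw [norm_smul, inner_smul_right, Real.norm_of_nonneg (by positivity)] at h
      rw [dist_comm, Real.dist_eq]
      have h2 : ((n : ℝ) + 1) * (H t (z + ((n : ℝ) + 1)⁻¹ • v) - H t z)
          - inner ℝ (gradient (H t) z) v
          = ((n : ℝ) + 1) * (H t (z + ((n : ℝ) + 1)⁻¹ • v) - H t z
            - ((n : ℝ) + 1)⁻¹ * inner ℝ (gradient (H t) z) v) := by
        field_simp
      rw [h2, abs_mul, abs_of_pos hn0]
      calc _ ≤ ((n : ℝ) + 1) * (K * (((n : ℝ) + 1)⁻¹ * ‖v‖) * (((n : ℝ) + 1)⁻¹ * ‖v‖)) :=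
            mul_le_mul_of_nonneg_left h hn0.le
        _ = _ := by field_simp
    refine hu.continuous (Frequently.of_forall fun n => ?_)
    have h1 : ∀ x : Plane, Continuous (fun t => H t x) := fun x =>
      hH.continuous.comp (by fun_prop : Continuous (fun t : ℝ => (t, x)))
    exact continuous_const.mul ((h1 _).sub (h1 _))
  have hrepr : (fun t => gradient (H t) z)
      = fun t => WithLp.toLp 2 (fun i => inner ℝ (gradient (H t) z) (EuclideanSpace.single i 1)) := by
    funext t
    ext i
    simp [EuclideanSpace.inner_single_right, -inner_gradient_left]
  rw [hrepr]
  refine (PiLp.continuous_toLp 2 _).comp (continuous_pi fun i => key _)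

/-- The vector field of the Hamiltonian system. -/
def field (H : ℝ → Plane → ℝ) (t : ℝ) (z : Plane) : Plane := act J (gradient (H t) z)

lemma IsRegularHamiltonian.continuous_field_time {T : ℝ} {H : ℝ → Plane → ℝ}
    (hH : IsRegularHamiltonian T H) (z : Plane) : Continuous (fun t => field H t z) :=
  (act J).continuous.comp (hH.continuous_gradient_time z)

lemma IsRegularHamiltonian.lipschitz_field {T : ℝ} {H : ℝ → Plane → ℝ}
    (hH : IsRegularHamiltonian T H) : ∃ K : ℝ≥0, ∀ t, LipschitzWith K (field H t) := by
  obtain ⟨K, hK⟩ := hH.lipschitz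
  exact ⟨‖act J‖₊ * K, fun t => (act J).lipschitz.comp (hK t)⟩

lemma IsRegularHamiltonian.continuous_gradient {T : ℝ} {H : ℝ → Plane → ℝ}
    (hH : IsRegularHamiltonian T H) : Continuous (fun q : ℝ × Plane => gradient (H q.1) q.2) := by
  obtain ⟨K, hK⟩ := hH.lipschitz
  exact continuous_prod_of_continuous_lipschitzWith' _ K hK hH.continuous_gradient_time

/-! ### Approximation by the linear system -/

/-- `z` is, on `[0, T]`, a solution of the Hamiltonian system. -/
def IsSolution (T : ℝ) (H : ℝ → Plane → ℝ) (z : ℝ → Plane) : Prop :=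
  ∀ t ∈ Icc 0 T, HasDerivWithinAt z (field H t (z t)) (Icc 0 T) t

/-- A common form of asymptotic linearity at zero and at infinity, for radii tending to `0` or to
infinity along the filter `l`: for each fixed `t` (not uniformly in `t`), the rescaled gradient
`u ↦ ∇ H t (r u) / r` tends to `A t`, uniformly on bounded sets. -/
structure IsAsymptoticallyLinearAlong (T : ℝ) (H : ℝ → Plane → ℝ) (A : ℝ → Mat)
    (l : Filter ℝ) : Prop where
  continuousOn : ContinuousOn A (Icc 0 T)
  pos : ∀ᶠ r in l, 0 < r
  bound : ∀ᶠ r in l, ∀ t ∈ Icc 0 T, ‖gradient (H t) 0‖ ≤ r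
  small : ∀ t ∈ Icc 0 T, ∀ C, ∀ ε > 0, ∀ᶠ r in l, ∀ u : Plane, ‖u‖ ≤ C →
    ‖gradient (H t) (r • u) - act (A t) (r • u)‖ ≤ ε * r

lemma IsAsymptoticallyLinearAtZero.along {T : ℝ} {H : ℝ → Plane → ℝ} {A : ℝ → Mat}
    (h : IsAsymptoticallyLinearAtZero T H A) :
    IsAsymptoticallyLinearAlong T H A (𝓝[>] 0) where
  continuousOn := h.continuousOn
  pos := self_mem_nhdsWithin
  bound := by
    filter_upwards [self_mem_nhdsWithin] with r hr t ht
    rw [h.gradient_zero t ht, norm_zero]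
    exact (mem_Ioi.1 hr).le
  small := by
    intro t ht C ε hε
    have h1 := (hasFDerivAt_iff_isLittleO_nhds_zero.1 (h.hessian t ht)).def
      (show 0 < ε / (|C| + 1) by positivity)
    simp only [zero_add, h.gradient_zero t ht, sub_zero] at h1
    obtain ⟨δ, hδ, h2⟩ := Metric.eventually_nhds_iff.1 h1
    have hmem : Ioo (0 : ℝ) (δ / (|C| + 1)) ∈ 𝓝[>] (0 : ℝ) :=
      Ioo_mem_nhdsGT (by positivity)
    filter_upwards [hmem] with r hr u hu
    have hC : ‖u‖ < |C| + 1 := by linarith [le_abs_self C]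
    have hn : ‖r • u‖ = r * ‖u‖ := by rw [norm_smul, Real.norm_of_nonneg hr.1.le]
    have h3 := h2 (y := r • u) (by
      rw [dist_zero_right, hn]
      calc r * ‖u‖ ≤ r * (|C| + 1) := mul_le_mul_of_nonneg_left hC.le hr.1.le
        _ < δ := (lt_div_iff₀ (by positivity)).1 hr.2)
    refine h3.trans ?_
    rw [hn]
    calc ε / (|C| + 1) * (r * ‖u‖) ≤ ε / (|C| + 1) * (r * (|C| + 1)) := by
          have := hr.1
          gcongr
      _ = ε * r := by field_simp

lemma continuous_act : Continuous (fun M : Mat => act M) :=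
  LinearMap.continuous_of_finiteDimensional
    ((Matrix.toEuclideanCLM (n := Fin 2) (𝕜 := ℝ)).toAlgEquiv.toLinearMap)

/-- The linear maps `act (A t)` of a continuous matrix path on a compact interval are bounded. -/
lemma exists_norm_act_le {T : ℝ} {A : ℝ → Mat} (hA : ContinuousOn A (Icc 0 T)) :
    ∃ β : ℝ, 0 ≤ β ∧ ∀ t ∈ Icc 0 T, ‖act (A t)‖ ≤ β := by
  obtain ⟨β, hβ⟩ := isCompact_Icc.exists_bound_of_continuousOn (continuous_act.comp_continuousOn hA)
  exact ⟨|β|, abs_nonneg _, fun t ht => (hβ t ht).trans (le_abs_self β)⟩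

lemma IsAsymptoticallyLinearAtInfinity.along {T : ℝ} {H : ℝ → Plane → ℝ} {A : ℝ → Mat}
    (hH : IsRegularHamiltonian T H) (h : IsAsymptoticallyLinearAtInfinity T H A) :
    IsAsymptoticallyLinearAlong T H A atTop where
  continuousOn := h.continuousOn
  pos := eventually_gt_atTop 0
  bound := by
    obtain ⟨b, hb⟩ := isCompact_Icc.exists_bound_of_continuousOn
      (hH.continuous_gradient_time 0).continuousOn (s := Icc 0 T)
    filter_upwards [eventually_ge_atTop b] with r hr t ht
    exact (hb t ht).trans hr
  small := by
    intro t ht C ε hε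
    obtain ⟨K, hK⟩ := hH.lipschitz
    obtain ⟨ρ, hρ, h1⟩ := h.tendsto (ε / (|C| + 1)) (by positivity)
    set m : ℝ := K * ρ + ‖gradient (H t) 0‖ + ‖act (A t)‖ * ρ with hm
    filter_upwards [eventually_gt_atTop 0, eventually_ge_atTop (m / ε)] with r hr0 hr u hu
    have hC : ‖u‖ < |C| + 1 := by linarith [le_abs_self C]
    have hn : ‖r • u‖ = r * ‖u‖ := by rw [norm_smul, Real.norm_of_nonneg hr0.le]
    by_cases hz : ρ < ‖r • u‖
    · have h2 := h1 t ht _ hz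
      rw [div_lt_iff₀ (hρ.trans hz)] at h2
      refine h2.le.trans ?_
      rw [hn]
      calc ε / (|C| + 1) * (r * ‖u‖) ≤ ε / (|C| + 1) * (r * (|C| + 1)) := by gcongr
        _ = ε * r := by field_simp
    · push Not at hz
      have h2 : ‖gradient (H t) (r • u)‖ ≤ K * ρ + ‖gradient (H t) 0‖ := by
        have h3 := (hK t).norm_sub_le (r • u) 0
        have h4 := norm_le_norm_sub_add (gradient (H t) (r • u)) (gradient (H t) 0)
        rw [sub_zero] at h3
        have h5 : (K : ℝ) * ‖r • u‖ ≤ K * ρ := mul_le_mul_of_nonneg_left hz K.2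
        linarith
      have h6 : ‖act (A t) (r • u)‖ ≤ ‖act (A t)‖ * ρ :=
        ((act (A t)).le_opNorm _).trans (mul_le_mul_of_nonneg_left hz (norm_nonneg _))
      have h7 := norm_sub_le (gradient (H t) (r • u)) (act (A t) (r • u))
      have h8 : m ≤ ε * r := by
        rw [div_le_iff₀ hε] at hr
        linarith
      linarith

/-- Solutions starting at distance `r` from the origin, divided by `r`, tend uniformly to
solutions of the linear system. As the linearisation need not be uniform in time, the error of the
equation tends to zero only pointwise in time and boundedly; its integral tends to zero by
dominated convergence along sequences of radii. -/
theorem IsAsymptoticallyLinearAlong.eventually_norm_sub_le {T : ℝ} (hT : 0 < T)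
    {H : ℝ → Plane → ℝ} (hH : IsRegularHamiltonian T H) {A Ψ : ℝ → Mat} {l : Filter ℝ}
    [l.IsCountablyGenerated] (h : IsAsymptoticallyLinearAlong T H A l)
    (hΨ : IsFundamentalMatrix T A Ψ) {η : ℝ} (hη : 0 < η) :
    ∀ᶠ r in l, ∀ z, IsSolution T H z → ‖z 0‖ = r → ∀ t ∈ Icc 0 T,
      ‖r⁻¹ • z t - act (Ψ t) (r⁻¹ • z 0)‖ ≤ η := by
  by_contra hcon
  have hfreq : ∃ᶠ r in l, (∃ z, IsSolution T H z ∧ ‖z 0‖ = r ∧ ∃ t ∈ Icc 0 T,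
      η < ‖r⁻¹ • z t - act (Ψ t) (r⁻¹ • z 0)‖) ∧ 0 < r ∧
      ∀ t ∈ Icc 0 T, ‖gradient (H t) 0‖ ≤ r := by
    refine Frequently.and_eventually ?_ (h.pos.and h.bound)
    refine (not_eventually.1 hcon).mono fun r hr => ?_
    push Not at hr
    exact hr
  obtain ⟨r, hrl, hr⟩ := exists_seq_forall_of_frequently hfreq
  choose hz hr0 hrb using hr
  choose z hsol hz0 τ hτ hτη using hz
  obtain ⟨α, hα0, hα⟩ := exists_norm_act_le h.continuousOn
  obtain ⟨K, hK⟩ := hH.lipschitz_field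
  set j : ℝ := ‖act J‖ with hj
  have hj0 : 0 ≤ j := norm_nonneg _
  -- the rescaled solutions are uniformly bounded
  set C : ℝ := gronwallBound 1 K j T with hC
  have hud : ∀ n, ∀ t ∈ Icc 0 T,
      HasDerivWithinAt (fun s => (r n)⁻¹ • z n s) ((r n)⁻¹ • field H t (z n t)) (Icc 0 T) t :=
    fun n t ht => (hsol n t ht).fun_const_smul _
  have hfield : ∀ n, ∀ t ∈ Icc 0 T,
      ‖(r n)⁻¹ • field H t (z n t)‖ ≤ K * ‖(r n)⁻¹ • z n t‖ + j := by
    intro n t ht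
    have h1 := (hK t).norm_sub_le (z n t) 0
    rw [sub_zero] at h1
    have h2 := norm_le_norm_sub_add (field H t (z n t)) (field H t 0)
    have h3 : ‖field H t 0‖ ≤ j * r n :=
      ((act J).le_opNorm _).trans (mul_le_mul_of_nonneg_left (hrb n t ht) hj0)
    rw [norm_smul, norm_smul, Real.norm_of_nonneg (inv_nonneg.2 (hr0 n).le)]
    have h4 : ‖field H t (z n t)‖ ≤ K * ‖z n t‖ + j * r n := by linarith
    calc (r n)⁻¹ * ‖field H t (z n t)‖ ≤ (r n)⁻¹ * (K * ‖z n t‖ + j * r n) :=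
          mul_le_mul_of_nonneg_left h4 (inv_nonneg.2 (hr0 n).le)
      _ = _ := by
          have := (hr0 n).ne'
          field_simp
  have hu0 : ∀ n, ‖(r n)⁻¹ • z n 0‖ = 1 := by
    intro n
    rw [norm_smul, hz0, Real.norm_of_nonneg (inv_nonneg.2 (hr0 n).le),
      inv_mul_cancel₀ (hr0 n).ne']
  have hub : ∀ n, ∀ t ∈ Icc 0 T, ‖(r n)⁻¹ • z n t‖ ≤ C := by
    intro n t ht
    have h1 := norm_le_gronwallBound_of_norm_deriv_right_le (K := (K : ℝ)) (ε := j)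
      (fun t ht => (hud n t ht).continuousWithinAt)
      (fun s hs => hasDerivWithinAt_Ici_of_Icc hs (hud n s (Ico_subset_Icc_self hs)))
      (hu0 n).le (fun s hs => hfield n s (Ico_subset_Icc_self hs)) t ht
    rw [sub_zero] at h1
    exact h1.trans (gronwallBound_mono zero_le_one hj0 K.2 ht.2)
  -- the error with which the rescaled solutions solve the linear equation
  set e : ℕ → ℝ → Plane := fun n t =>
    (r n)⁻¹ • field H t (z n t) - act J (act (A t) ((r n)⁻¹ • z n t)) with he
  have heq : ∀ n t, e n t = (r n)⁻¹ • act J (gradient (H t) (z n t) - act (A t) (z n t)) := by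
    intro n t
    simp only [he, field, map_sub, map_smul, smul_sub]
  have hec : ∀ n, ContinuousOn (e n) (Icc 0 T) := by
    intro n
    have hzc : ContinuousOn (z n) (Icc 0 T) := fun t ht => (hsol n t ht).continuousWithinAt
    have h1 : ContinuousOn (fun t => gradient (H t) (z n t)) (Icc 0 T) :=
      hH.continuous_gradient.comp_continuousOn (continuousOn_id.prodMk hzc)
    have h2 : ContinuousOn (fun t => act (A t) (z n t)) (Icc 0 T) :=
      (continuous_act.comp_continuousOn h.continuousOn).clm_apply hzc
    refine ContinuousOn.congr ?_ (fun t _ => heq n t)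
    exact ((act J).continuous.comp_continuousOn (h1.sub h2)).const_smul (r n)⁻¹
  have heb : ∀ n, ∀ t ∈ Icc 0 T, ‖e n t‖ ≤ K * C + j + j * (α * C) := by
    intro n t ht
    refine (norm_sub_le _ _).trans (add_le_add ?_ ?_)
    · exact (hfield n t ht).trans
        (add_le_add_left (mul_le_mul_of_nonneg_left (hub n t ht) K.2) _)
    · refine ((act J).le_opNorm _).trans (mul_le_mul_of_nonneg_left ?_ hj0)
      exact ((act (A t)).le_of_opNorm_le (hα t ht) _).trans
        (mul_le_mul_of_nonneg_left (hub n t ht) hα0)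
  have hlim : ∀ t ∈ Icc 0 T, Tendsto (fun n => e n t) atTop (𝓝 0) := by
    intro t ht
    rw [tendsto_zero_iff_norm_tendsto_zero, Metric.tendsto_atTop']
    intro ε hε
    have h1 := hrl.eventually (h.small t ht C (ε / (2 * (j + 1))) (by positivity))
    obtain ⟨N, hN⟩ := eventually_atTop.1 h1
    refine ⟨N, fun n hn => ?_⟩
    have h2 := hN n hn.le _ (hub n t ht)
    rw [smul_inv_smul₀ (hr0 n).ne'] at h2
    rw [dist_zero_right, norm_norm, heq, norm_smul, Real.norm_of_nonneg (inv_nonneg.2 (hr0 n).le)]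
    have h3 : ‖act J (gradient (H t) (z n t) - act (A t) (z n t))‖
        ≤ j * (ε / (2 * (j + 1)) * r n) :=
      ((act J).le_opNorm _).trans (mul_le_mul_of_nonneg_left h2 hj0)
    calc _ ≤ (r n)⁻¹ * (j * (ε / (2 * (j + 1)) * r n)) :=
          mul_le_mul_of_nonneg_left h3 (inv_nonneg.2 (hr0 n).le)
      _ = (j / (j + 1)) * (ε / 2) := by
          have := (hr0 n).ne'
          field_simp
      _ ≤ 1 * (ε / 2) := by
          refine mul_le_mul_of_nonneg_right ?_ (by positivity)
          rw [div_le_one (by positivity)]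
          linarith
      _ < ε := by linarith
  -- extended continuously to the whole line, so that its primitive is differentiable everywhere
  set e' : ℕ → ℝ → Plane := fun n t => e n (projIcc 0 T hT.le t) with he'
  have hee' : ∀ n, ∀ t ∈ Icc 0 T, e' n t = e n t := by
    intro n t ht
    simp only [he', projIcc_of_mem hT.le ht]
  have he'c : ∀ n, Continuous (e' n) := fun n =>
    (hec n).comp_continuous (continuous_subtype_val.comp continuous_projIcc)
      (fun t => (projIcc 0 T hT.le t).2)
  have hint : Tendsto (fun n => ∫ t in (0 : ℝ)..T, ‖e' n t‖) atTop (𝓝 0) := by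
    have h1 := intervalIntegral.tendsto_integral_filter_of_dominated_convergence
      (μ := MeasureTheory.volume) (a := 0) (b := T) (l := atTop)
      (F := fun n t => ‖e' n t‖) (f := fun _ => (0 : ℝ))
      (fun _ => K * C + j + j * (α * C))
      (Eventually.of_forall fun n => (he'c n).norm.aestronglyMeasurable)
      (Eventually.of_forall fun n => Eventually.of_forall fun t _ => by
        rw [norm_norm]
        exact heb n _ (projIcc 0 T hT.le t).2)
      intervalIntegrable_const
      (Eventually.of_forall fun t _ => by
        have := (hlim _ (projIcc 0 T hT.le t).2).norm
        rwa [norm_zero] at this)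
    simpa using h1
  set P : ℕ → ℝ → Plane := fun n t => ∫ s in (0 : ℝ)..t, e' n s with hP
  have hPd : ∀ n, ∀ t ∈ Icc 0 T, HasDerivWithinAt (P n) (e n t) (Icc 0 T) t := by
    intro n t ht
    rw [← hee' n t ht]
    exact ((he'c n).integral_hasStrictDerivAt 0 t).hasDerivAt.hasDerivWithinAt
  have hPb : ∀ n, ∀ t ∈ Icc 0 T, ‖P n t‖ ≤ ∫ s in (0 : ℝ)..T, ‖e' n s‖ := by
    intro n t ht
    refine (intervalIntegral.norm_integral_le_integral_norm ht.1).trans ?_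
    exact intervalIntegral.integral_mono_interval le_rfl ht.1 ht.2
      (Eventually.of_forall fun s => norm_nonneg _) ((he'c n).norm.intervalIntegrable _ _)
  -- Grönwall's inequality for the difference
  set β : ℝ := j * α with hβ
  have hβ0 : 0 ≤ β := mul_nonneg hj0 hα0
  have hyd : ∀ n, ∀ t ∈ Icc 0 T, HasDerivWithinAt
      (fun s => (r n)⁻¹ • z n s - act (Ψ s) ((r n)⁻¹ • z n 0))
      (((act J).comp (act (A t))) ((r n)⁻¹ • z n t - act (Ψ t) ((r n)⁻¹ • z n 0)) + e n t)
      (Icc 0 T) t := by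
    intro n t ht
    refine ((hud n t ht).fun_sub (hΨ.solution ((r n)⁻¹ • z n 0) t ht)).congr_deriv ?_
    simp only [he, ContinuousLinearMap.comp_apply, map_sub]
    abel
  have hfin : ∀ n, η < (∫ s in (0 : ℝ)..T, ‖e' n s‖)
      + gronwallBound 0 β (β * ∫ s in (0 : ℝ)..T, ‖e' n s‖) T := by
    intro n
    refine (hτη n).trans_le ?_
    refine norm_le_of_primitive_le hβ0
      (intervalIntegral.integral_nonneg hT.le fun _ _ => norm_nonneg _)
      (B := fun t => (act J).comp (act (A t))) (fun t ht => ?_) (hyd n) ?_ (hPd n) (by simp [hP])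
      (hPb n) (hτ n)
    · exact ((act J).opNorm_comp_le _).trans (mul_le_mul_of_nonneg_left (hα t ht) hj0)
    · simp [hΨ.init]
  have hlim2 : Tendsto (fun n => (∫ s in (0 : ℝ)..T, ‖e' n s‖)
      + gronwallBound 0 β (β * ∫ s in (0 : ℝ)..T, ‖e' n s‖) T) atTop (𝓝 0) := by
    have h1 : Continuous (fun x : ℝ => x + gronwallBound 0 β (β * x) T) :=
      continuous_id.add ((gronwallBound_continuous_ε 0 β T).comp (continuous_const_mul β))
    have h2 := (h1.tendsto 0).comp hint
    simp only [mul_zero, gronwallBound_ε0_δ0, add_zero] at h2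
    exact h2
  have := ge_of_tendsto' hlim2 (fun n => (hfin n).le)
  linarith

/-! ### Polar coordinates relative to a moving frame -/

/-- The unit vector of clockwise angle `φ`. -/
def unitVec (φ : ℝ) : Plane := polarProj φ 1

/-- The component of `z` along the unit vector of clockwise angle `a`. -/
def frameRe (a : ℝ) (z : Plane) : ℝ := z 0 * Real.cos a - z 1 * Real.sin a

/-- The component of `z` along the unit vector of clockwise angle `a + π / 2`. -/
def frameIm (a : ℝ) (z : Plane) : ℝ := -(z 0 * Real.sin a) - z 1 * Real.cos a

/-- The clockwise angle in `(-π / 2, π / 2)` from the unit vector of clockwise angle `a` to `z`;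
meaningful when `0 < frameRe a z`. -/
def relAngle (a : ℝ) (z : Plane) : ℝ := Real.arctan (frameIm a z / frameRe a z)

@[simp] lemma polarProj_zero (φ r : ℝ) : polarProj φ r 0 = r * Real.cos φ := rfl
@[simp] lemma polarProj_one (φ r : ℝ) : polarProj φ r 1 = -(r * Real.sin φ) := rfl
@[simp] lemma unitVec_zero (φ : ℝ) : unitVec φ 0 = Real.cos φ := by simp [unitVec]
@[simp] lemma unitVec_one (φ : ℝ) : unitVec φ 1 = -Real.sin φ := by simp [unitVec]

lemma plane_ext {z w : Plane} (h0 : z 0 = w 0) (h1 : z 1 = w 1) : z = w := by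
  ext i; fin_cases i <;> assumption

lemma polarProj_eq_smul (φ r : ℝ) : polarProj φ r = r • unitVec φ :=
  plane_ext (by simp) (by simp)

lemma norm_sq_plane (z : Plane) : ‖z‖ ^ 2 = z 0 ^ 2 + z 1 ^ 2 := by
  rw [EuclideanSpace.norm_sq_eq, Fin.sum_univ_two]
  simp

lemma norm_unitVec (φ : ℝ) : ‖unitVec φ‖ = 1 := by
  have h := norm_sq_plane (unitVec φ)
  rw [unitVec_zero, unitVec_one, neg_sq, Real.cos_sq_add_sin_sq] at h
  exact (pow_eq_one_iff_of_nonneg (norm_nonneg _) two_ne_zero).1 h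

lemma unitVec_ne_zero (φ : ℝ) : unitVec φ ≠ 0 := by
  rw [← norm_pos_iff, norm_unitVec]
  exact one_pos

lemma norm_polarProj {φ r : ℝ} (hr : 0 ≤ r) : ‖polarProj φ r‖ = r := by
  rw [polarProj_eq_smul, norm_smul, norm_unitVec, mul_one, Real.norm_of_nonneg hr]

lemma continuous_toPlane {X : Type*} [TopologicalSpace X] {f g : X → ℝ} (hf : Continuous f)
    (hg : Continuous g) : Continuous (fun x => (!₂[f x, g x] : Plane)) := by
  refine (PiLp.continuous_toLp 2 _).comp (continuous_pi fun i => ?_)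
  fin_cases i <;> simpa

lemma continuous_polarProj : Continuous (fun q : ℝ × ℝ => polarProj q.1 q.2) :=
  continuous_toPlane (by fun_prop) (by fun_prop)

lemma continuous_unitVec : Continuous unitVec :=
  continuous_polarProj.comp (by fun_prop : Continuous (fun φ : ℝ => (φ, (1 : ℝ))))

lemma unitVec_add_two_pi (φ : ℝ) : unitVec (φ + 2 * Real.pi) = unitVec φ :=
  plane_ext (by simp) (by simp)

lemma polarProj_add_two_pi (φ r : ℝ) : polarProj (φ + 2 * Real.pi) r = polarProj φ r := by
  simp only [polarProj_eq_smul, unitVec_add_two_pi]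

lemma frameRe_sq_add_frameIm_sq (a : ℝ) (z : Plane) :
    frameRe a z ^ 2 + frameIm a z ^ 2 = ‖z‖ ^ 2 := by
  rw [norm_sq_plane]
  simp only [frameRe, frameIm]
  linear_combination (z 0 ^ 2 + z 1 ^ 2) * Real.sin_sq_add_cos_sq a

lemma abs_frameRe_le (a : ℝ) (z : Plane) : |frameRe a z| ≤ ‖z‖ := by
  refine abs_le_of_sq_le_sq ?_ (norm_nonneg z)
  nlinarith [frameRe_sq_add_frameIm_sq a z, sq_nonneg (frameIm a z)]

lemma abs_frameIm_le (a : ℝ) (z : Plane) : |frameIm a z| ≤ ‖z‖ := by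
  refine abs_le_of_sq_le_sq ?_ (norm_nonneg z)
  nlinarith [frameRe_sq_add_frameIm_sq a z, sq_nonneg (frameRe a z)]

lemma frameRe_sub (a : ℝ) (z w : Plane) : frameRe a (z - w) = frameRe a z - frameRe a w := by
  simp only [frameRe, PiLp.sub_apply]; ring

lemma frameIm_sub (a : ℝ) (z w : Plane) : frameIm a (z - w) = frameIm a z - frameIm a w := by
  simp only [frameIm, PiLp.sub_apply]; ring

lemma frameRe_smul (a c : ℝ) (z : Plane) : frameRe a (c • z) = c * frameRe a z := by
  simp only [frameRe, PiLp.smul_apply, smul_eq_mul]; ring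

lemma frameIm_smul (a c : ℝ) (z : Plane) : frameIm a (c • z) = c * frameIm a z := by
  simp only [frameIm, PiLp.smul_apply, smul_eq_mul]; ring

lemma relAngle_smul (a : ℝ) {c : ℝ} (hc : c ≠ 0) (z : Plane) :
    relAngle a (c • z) = relAngle a z := by
  rw [relAngle, frameRe_smul, frameIm_smul, mul_div_mul_left _ _ hc, relAngle]

lemma frameRe_polarProj (a φ r : ℝ) : frameRe a (polarProj φ r) = r * Real.cos (φ - a) := by
  simp only [frameRe, polarProj_zero, polarProj_one, Real.cos_sub]; ring

lemma frameIm_polarProj (a φ r : ℝ) : frameIm a (polarProj φ r) = r * Real.sin (φ - a) := by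
  simp only [frameIm, polarProj_zero, polarProj_one, Real.sin_sub]; ring

lemma abs_relAngle_lt (a : ℝ) (z : Plane) : |relAngle a z| < Real.pi / 2 :=
  abs_lt.2 ⟨Real.neg_pi_div_two_lt_arctan _, Real.arctan_lt_pi_div_two _⟩

lemma relAngle_add_two_pi (a : ℝ) (z : Plane) : relAngle (a + 2 * Real.pi) z = relAngle a z := by
  simp only [relAngle, frameRe, frameIm, Real.cos_add_two_pi, Real.sin_add_two_pi]

lemma abs_arctan_le (x : ℝ) : |Real.arctan x| ≤ |x| := by
  have key : ∀ y : ℝ, 0 ≤ y → Real.arctan y ≤ y := fun y hy => by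
    have h := Real.le_tan (Real.arctan_nonneg.2 hy) (Real.arctan_lt_pi_div_two y)
    rwa [Real.tan_arctan] at h
  rcases le_total 0 x with hx | hx
  · rw [abs_of_nonneg hx, abs_of_nonneg (Real.arctan_nonneg.2 hx)]
    exact key x hx
  · have h := key (-x) (by linarith)
    rw [Real.arctan_neg] at h
    have h0 : 0 ≤ Real.arctan (-x) := Real.arctan_nonneg.2 (by linarith)
    rw [Real.arctan_neg] at h0
    rwa [abs_of_nonpos hx, abs_of_nonpos (by linarith)]

/-- A vector in the open half plane around the direction `a` has the angle `a + relAngle a z`. -/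
lemma polarProj_add_relAngle {a : ℝ} {z : Plane} (h : 0 < frameRe a z) :
    polarProj (a + relAngle a z) ‖z‖ = z := by
  set x := frameIm a z / frameRe a z with hx
  have h1 : ‖z‖ = frameRe a z * √(1 + x ^ 2) := by
    rw [← Real.sqrt_sq (norm_nonneg z), ← frameRe_sq_add_frameIm_sq a z]
    have h2 : frameRe a z ^ 2 + frameIm a z ^ 2 = frameRe a z ^ 2 * (1 + x ^ 2) := by
      rw [hx]; field_simp
    rw [h2, Real.sqrt_mul (sq_nonneg _), Real.sqrt_sq h.le]
  have hs : 0 < √(1 + x ^ 2) := Real.sqrt_pos.2 (by positivity)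
  have hc : ‖z‖ * Real.cos (relAngle a z) = frameRe a z := by
    rw [relAngle, Real.cos_arctan, ← hx, h1]
    field_simp
  have hi : ‖z‖ * Real.sin (relAngle a z) = frameIm a z := by
    rw [relAngle, Real.sin_arctan, ← hx, h1, hx]
    rw [hx] at hs
    field_simp
  refine plane_ext ?_ ?_
  · rw [polarProj_zero, Real.cos_add]
    have : ‖z‖ * (Real.cos a * Real.cos (relAngle a z) - Real.sin a * Real.sin (relAngle a z))
      = Real.cos a * frameRe a z - Real.sin a * frameIm a z := by rw [← hc, ← hi]; ring
    rw [this]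
    simp only [frameRe, frameIm]
    linear_combination z 0 * Real.sin_sq_add_cos_sq a
  · rw [polarProj_one, Real.sin_add]
    have : ‖z‖ * (Real.sin a * Real.cos (relAngle a z) + Real.cos a * Real.sin (relAngle a z))
      = Real.sin a * frameRe a z + Real.cos a * frameIm a z := by rw [← hc, ← hi]; ring
    rw [this]
    simp only [frameRe, frameIm]
    linear_combination z 1 * Real.sin_sq_add_cos_sq a

lemma continuousOn_relAngle {X : Type*} [TopologicalSpace X] {s : Set X} {a : X → ℝ}
    {z : X → Plane} (ha : ContinuousOn a s) (hz : ContinuousOn z s)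
    (h : ∀ x ∈ s, frameRe (a x) (z x) ≠ 0) : ContinuousOn (fun x => relAngle (a x) (z x)) s := by
  have h0 : ContinuousOn (fun x => z x 0) s :=
    (EuclideanSpace.proj (𝕜 := ℝ) (0 : Fin 2)).continuous.comp_continuousOn hz
  have h1 : ContinuousOn (fun x => z x 1) s :=
    (EuclideanSpace.proj (𝕜 := ℝ) (1 : Fin 2)).continuous.comp_continuousOn hz
  have hc := Real.continuous_cos.comp_continuousOn ha
  have hs := Real.continuous_sin.comp_continuousOn ha
  refine Real.continuous_arctan.comp_continuousOn (ContinuousOn.div ?_ ?_ h)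
  · exact (h0.mul hs).neg.sub (h1.mul hc)
  · exact (h0.mul hc).sub (h1.mul hs)

lemma cos_sub_eq_one_of_polarProj_eq {φ ψ r s : ℝ} (hr : 0 < r) (hs : 0 < s)
    (h : polarProj φ r = polarProj ψ s) : Real.cos (φ - ψ) = 1 := by
  have hrs : r = s := by rw [← norm_polarProj hr.le, h, norm_polarProj hs.le]
  have h1 : frameRe ψ (polarProj φ r) = r := by
    rw [h, frameRe_polarProj, sub_self, Real.cos_zero, mul_one, hrs]
  rw [frameRe_polarProj] at h1
  exact mul_left_cancel₀ hr.ne' (by rw [h1, mul_one])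

/-- Continuous angles of the same path which agree at the start agree at the end. -/
lemma angle_unique {T : ℝ} (hT : 0 ≤ T) {p q : ℝ → ℝ × ℝ} (hp : ContinuousOn p (Icc 0 T))
    (hq : ContinuousOn q (Icc 0 T)) (hp0 : ∀ t ∈ Icc 0 T, 0 < (p t).2)
    (hq0 : ∀ t ∈ Icc 0 T, 0 < (q t).2)
    (h : ∀ t ∈ Icc 0 T, polarProj (p t).1 (p t).2 = polarProj (q t).1 (q t).2)
    (h0 : (p 0).1 = (q 0).1) : (p T).1 = (q T).1 := by
  set d : ℝ → ℝ := fun t => |(p t).1 - (q t).1| with hd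
  have hdc : ContinuousOn d (Icc 0 T) :=
    ((continuous_fst.comp_continuousOn hp).sub (continuous_fst.comp_continuousOn hq)).abs
  have hcos : ∀ t ∈ Icc 0 T, Real.cos (d t) = 1 := fun t ht => by
    rw [hd, Real.cos_abs]
    exact cos_sub_eq_one_of_polarProj_eq (hp0 t ht) (hq0 t ht) (h t ht)
  by_contra hne
  have hpos : 0 < d T := abs_pos.2 (sub_ne_zero.2 hne)
  have hd0 : d 0 = 0 := by simp [hd, h0]
  -- a value of the difference at which the cosine is not `1`
  have hmem : min (d T) Real.pi ∈ Icc (d 0) (d T) := by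
    rw [hd0]
    exact ⟨le_min hpos.le Real.pi_pos.le, min_le_left _ _⟩
  obtain ⟨t, ht, htd⟩ := intermediate_value_Icc hT hdc hmem
  have h1 := hcos t ht
  rw [htd] at h1
  have h2 := (Real.cos_eq_one_iff_of_lt_of_lt
    (by linarith [lt_min hpos Real.pi_pos, Real.pi_pos])
    (by linarith [min_le_right (d T) Real.pi, Real.pi_pos])).1 h1
  linarith [lt_min hpos Real.pi_pos]

/-! ### Symplectic matrices and the angle of a linear path -/

lemma act_zero (M : Mat) (z : Plane) : act M z 0 = M 0 0 * z 0 + M 0 1 * z 1 := by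
  simp [Matrix.ofLp_toEuclideanCLM, Matrix.mulVec, dotProduct, Fin.sum_univ_two]

lemma act_one (M : Mat) (z : Plane) : act M z 1 = M 1 0 * z 0 + M 1 1 * z 1 := by
  simp [Matrix.ofLp_toEuclideanCLM, Matrix.mulVec, dotProduct, Fin.sum_univ_two]

lemma act_mul (M N : Mat) (z : Plane) : act (M * N) z = act M (act N z) := by
  simp [act, map_mul]

lemma act_rot_unitVec (θ φ : ℝ) : act (rot θ) (unitVec φ) = unitVec (φ + θ) := by
  refine plane_ext ?_ ?_
  · simp only [act_zero, rot, unitVec_zero, unitVec_one, Real.cos_add, Matrix.of_apply,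
      Matrix.cons_val', Matrix.cons_val_zero, Matrix.cons_val_one, Matrix.cons_val_fin_one]
    ring
  · simp only [act_one, rot, unitVec_zero, unitVec_one, Real.sin_add, Matrix.of_apply,
      Matrix.cons_val', Matrix.cons_val_zero, Matrix.cons_val_one, Matrix.cons_val_fin_one]
    ring

/-- The hyperbolic rotations are positive definite. -/
lemma frameRe_hyp_pos {τ : ℝ} (hτ : 0 ≤ τ) (σ β : ℝ) :
    0 < frameRe β (act (hyp τ σ) (unitVec β)) := by
  have h : frameRe β (act (hyp τ σ) (unitVec β))
      = Real.cosh τ + Real.sinh τ * Real.cos (σ + 2 * β) := by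
    simp only [frameRe, act_zero, act_one, hyp, unitVec_zero, unitVec_one, Real.cos_add,
      Real.cos_two_mul', Real.sin_two_mul, Matrix.of_apply,
      Matrix.cons_val', Matrix.cons_val_zero, Matrix.cons_val_one, Matrix.cons_val_fin_one]
    linear_combination Real.cosh τ * Real.sin_sq_add_cos_sq β
  rw [h]
  have h1 := Real.neg_one_le_cos (σ + 2 * β)
  have h2 : 0 ≤ Real.sinh τ := Real.sinh_nonneg_iff.2 hτ
  have h3 := Real.sinh_lt_cosh τ
  nlinarith

lemma IsSymplectic.det_eq_one {M : Mat} (h : IsSymplectic M) : M.det = 1 := by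
  have h1 := congrFun (congrFun h 0) 1
  simp only [J, Matrix.mul_apply, Fin.sum_univ_two, Matrix.transpose_apply, Matrix.of_apply,
    Matrix.cons_val', Matrix.cons_val_zero, Matrix.cons_val_one, Matrix.cons_val_fin_one] at h1
  rw [Matrix.det_fin_two]
  linarith

lemma det_one_sub {M : Mat} (h : M.det = 1) : (1 - M).det = 2 - M.trace := by
  rw [Matrix.det_fin_two] at h ⊢
  simp only [Matrix.sub_apply, Matrix.one_apply_eq, Matrix.trace_fin_two, ne_eq, zero_ne_one,
    not_false_eq_true, Matrix.one_apply_ne, one_ne_zero]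
  linarith

lemma act_ne_zero {M : Mat} (h : M.det = 1) {z : Plane} (hz : z ≠ 0) : act M z ≠ 0 := by
  intro h0
  apply hz
  have e0 : act M z 0 = 0 := by rw [h0]; rfl
  have e1 : act M z 1 = 0 := by rw [h0]; rfl
  rw [act_zero] at e0
  rw [act_one] at e1
  rw [Matrix.det_fin_two] at h
  refine plane_ext ?_ ?_
  · change z 0 = 0
    linear_combination -(z 0) * h + M 1 1 * e0 - M 0 1 * e1
  · change z 1 = 0
    linear_combination -(z 1) * h - M 1 0 * e0 + M 0 0 * e1

/-- An eigenvalue `c ≠ 0` of a matrix with determinant `1` determines its trace. -/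
lemma trace_eq_of_act_eq_smul {M : Mat} (h : M.det = 1) {z : Plane} (hz : z ≠ 0) {c : ℝ}
    (hc : c ≠ 0) (hzc : act M z = c • z) : M.trace = c + c⁻¹ := by
  have e0 : M 0 0 * z 0 + M 0 1 * z 1 = c * z 0 := by rw [← act_zero, hzc]; rfl
  have e1 : M 1 0 * z 0 + M 1 1 * z 1 = c * z 1 := by rw [← act_one, hzc]; rfl
  rw [Matrix.det_fin_two] at h
  have hq : c ^ 2 - M.trace * c + 1 = 0 := by
    rw [Matrix.trace_fin_two]
    have h0 : z 0 * (c ^ 2 - (M 0 0 + M 1 1) * c + 1) = 0 := by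
      linear_combination (-(z 0)) * h + (M 1 1 - c) * e0 - M 0 1 * e1
    have h1 : z 1 * (c ^ 2 - (M 0 0 + M 1 1) * c + 1) = 0 := by
      linear_combination (-(z 1)) * h + (M 0 0 - c) * e1 - M 1 0 * e0
    by_contra hne
    exact hz (plane_ext ((mul_eq_zero.1 h0).resolve_right hne)
      ((mul_eq_zero.1 h1).resolve_right hne))
  field_simp
  linarith

/-- The continuous clockwise angle of `s ↦ Ψ s (unitVec φ)`, for a symplectic path `Ψ` with
rotation angle `θ`: the positive definite factor of `Ψ s` turns a vector by less than `π / 2`. -/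
def linAngle (Ψ : ℝ → Mat) (θ : ℝ → ℝ) (φ s : ℝ) : ℝ :=
  φ + θ s + relAngle (φ + θ s) (act (Ψ s) (unitVec φ))

section LinAngle

variable {S : ℝ} {Ψ : ℝ → Mat} {θ : ℝ → ℝ}

lemma IsRotationAngle.frameRe_pos (h : IsRotationAngle S Ψ θ) (φ : ℝ) {s : ℝ}
    (hs : s ∈ Icc 0 S) : 0 < frameRe (φ + θ s) (act (Ψ s) (unitVec φ)) := by
  obtain ⟨τ, σ, hτ, hd⟩ := h.decomp s hs
  rw [hd, act_mul, act_rot_unitVec]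
  exact frameRe_hyp_pos hτ _ _

lemma IsRotationAngle.polarProj_linAngle (h : IsRotationAngle S Ψ θ) (φ : ℝ) {s : ℝ}
    (hs : s ∈ Icc 0 S) :
    polarProj (linAngle Ψ θ φ s) ‖act (Ψ s) (unitVec φ)‖ = act (Ψ s) (unitVec φ) :=
  polarProj_add_relAngle (h.frameRe_pos φ hs)

lemma IsRotationAngle.continuousOn_linAngle (h : IsRotationAngle S Ψ θ)
    (hΨ : ContinuousOn Ψ (Icc 0 S)) (φ : ℝ) : ContinuousOn (linAngle Ψ θ φ) (Icc 0 S) := by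
  have h1 : ContinuousOn (fun s => φ + θ s) (Icc 0 S) := continuousOn_const.add h.continuousOn
  exact h1.add (continuousOn_relAngle h1
    ((continuous_act.comp_continuousOn hΨ).clm_apply continuousOn_const)
    fun s hs => (h.frameRe_pos φ hs).ne')

lemma IsRotationAngle.continuous_linAngle (h : IsRotationAngle S Ψ θ) {s : ℝ}
    (hs : s ∈ Icc 0 S) : Continuous (fun φ => linAngle Ψ θ φ s) := by
  have h1 : Continuous (fun φ => φ + θ s) := by fun_prop
  refine h1.add (continuousOn_univ.1 (continuousOn_relAngle h1.continuousOn
    ((act (Ψ s)).continuous.comp continuous_unitVec).continuousOn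
    fun φ _ => (h.frameRe_pos φ hs).ne'))

lemma linAngle_add_two_pi (φ s : ℝ) :
    linAngle Ψ θ (φ + 2 * Real.pi) s = linAngle Ψ θ φ s + 2 * Real.pi := by
  have h : φ + 2 * Real.pi + θ s = φ + θ s + 2 * Real.pi := by ring
  rw [linAngle, h, unitVec_add_two_pi, relAngle_add_two_pi, linAngle]
  ring

lemma IsRotationAngle.linAngle_zero (h : IsRotationAngle S Ψ θ) (hΨ : Ψ 0 = 1) (φ : ℝ) :
    linAngle Ψ θ φ 0 = φ := by
  have h1 : act (Ψ 0) (unitVec φ) = polarProj φ 1 := by simp [hΨ, act, unitVec]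
  rw [linAngle, h1, h.init, add_zero, relAngle, frameIm_polarProj]
  simp

lemma abs_linAngle_sub_lt (φ s : ℝ) : |linAngle Ψ θ φ s - φ - θ s| < Real.pi / 2 := by
  have : linAngle Ψ θ φ s - φ - θ s = relAngle (φ + θ s) (act (Ψ s) (unitVec φ)) := by
    rw [linAngle]; ring
  rw [this]
  exact abs_relAngle_lt _ _

/-- When the angles of `Ψ s z` and `z` differ by a multiple of `π`, `z` is an eigenvector. -/
lemma IsRotationAngle.act_eq_smul (h : IsRotationAngle S Ψ θ) {φ s : ℝ}
    (hs : s ∈ Icc 0 S) {k : ℤ} (hk : linAngle Ψ θ φ s - φ = k * Real.pi) :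
    act (Ψ s) (unitVec φ) = (Real.cos (k * Real.pi) * ‖act (Ψ s) (unitVec φ)‖) • unitVec φ := by
  have h1 := h.polarProj_linAngle φ hs
  have h2 : linAngle Ψ θ φ s = φ + k * Real.pi := by linarith
  rw [h2] at h1
  rw [← h1, norm_polarProj (norm_nonneg _)]
  have h3 : Real.sin (k * Real.pi) = 0 := Real.sin_int_mul_pi k
  refine plane_ext ?_ ?_
  · simp only [polarProj_zero, PiLp.smul_apply, smul_eq_mul, unitVec_zero, Real.cos_add, h3]
    ring
  · simp only [polarProj_one, PiLp.smul_apply, smul_eq_mul, unitVec_one, Real.sin_add, h3]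
    ring

end LinAngle

/-! ### Computation of degrees -/

lemma exists_polarProj_norm (z : Plane) : ∃ φ, polarProj φ ‖z‖ = z := by
  set w : ℂ := ⟨z 0, -z 1⟩ with hw
  have hn : ‖w‖ = ‖z‖ := by
    rw [← sq_eq_sq₀ (norm_nonneg _) (norm_nonneg _), norm_sq_plane, Complex.sq_norm,
      Complex.normSq_apply]
    simp only [hw]
    ring
  refine ⟨w.arg, plane_ext ?_ ?_⟩
  · rw [polarProj_zero, ← hn, Complex.norm_mul_cos_arg]
  · rw [polarProj_one, ← hn, Complex.norm_mul_sin_arg]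
    simp [hw]

/-- A closed curve, as a function of the angle, extends to a continuous positively homogeneous map
of the plane. -/
lemma exists_homogeneous_extension {c : ℝ → Plane} (hc : Continuous c)
    (hper : ∀ φ, c (φ + 2 * Real.pi) = c φ) :
    ∃ C : Plane → Plane, Continuous C ∧ ∀ φ s, 0 ≤ s → C (polarProj φ s) = s • c φ := by
  choose a ha using exists_polarProj_norm
  have hC : ∀ φ s, 0 ≤ s → ‖polarProj φ s‖ • c (a (polarProj φ s)) = s • c φ := by
    intro φ s hs
    rw [norm_polarProj hs]
    rcases hs.eq_or_lt with rfl | hs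
    · simp
    · have h1 := ha (polarProj φ s)
      rw [norm_polarProj hs.le] at h1
      obtain ⟨n, hn⟩ := (Real.cos_eq_one_iff _).1 (cos_sub_eq_one_of_polarProj_eq hs hs h1)
      have h2 : a (polarProj φ s) = φ + n * (2 * Real.pi) := by linarith
      have hp : Function.Periodic c (2 * Real.pi) := hper
      rw [h2, hp.int_mul n φ]
  refine ⟨fun z => ‖z‖ • c (a z), ?_, hC⟩
  rw [continuous_iff_continuousAt]
  intro z
  by_cases hz : z = 0
  · -- at the origin the extension is bounded by a multiple of the norm
    obtain ⟨B, hB⟩ := (Function.Periodic.isBounded_of_continuous (c := 2 * Real.pi) hper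
      (by positivity) hc).exists_norm_le
    have h0 : Tendsto (fun z : Plane => ‖z‖ * B) (𝓝 0) (𝓝 0) := by
      have : Continuous (fun z : Plane => ‖z‖ * B) := by fun_prop
      simpa using this.tendsto 0
    rw [hz]
    have h1 : Tendsto (fun z : Plane => ‖z‖ • c (a z)) (𝓝 0) (𝓝 0) := by
      refine squeeze_zero_norm (fun w => ?_) h0
      rw [norm_smul, norm_norm]
      exact mul_le_mul_of_nonneg_left (hB _ (mem_range_self _)) (norm_nonneg _)
    simpa [ContinuousAt] using h1
  · -- near another point `z` the angle is a continuous function in the frame of `z`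
    have hopen : IsOpen {w : Plane | 0 < frameRe (a z) w} := by
      refine isOpen_lt continuous_const ?_
      unfold frameRe
      fun_prop
    have hmem : z ∈ {w : Plane | 0 < frameRe (a z) w} := by
      have h1 : frameRe (a z) z = ‖z‖ := by
        have h2 := frameRe_polarProj (a z) (a z) ‖z‖
        rwa [ha z, sub_self, Real.cos_zero, mul_one] at h2
      change 0 < frameRe (a z) z
      rw [h1]
      exact norm_pos_iff.2 hz
    have hcon : ContinuousOn (fun w : Plane => ‖w‖ • c (a z + relAngle (a z) w))
        {w : Plane | 0 < frameRe (a z) w} := by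
      refine continuous_norm.continuousOn.smul (hc.comp_continuousOn ?_)
      exact continuousOn_const.add (continuousOn_relAngle continuousOn_const continuousOn_id
        fun w (hw : 0 < frameRe (a z) w) => hw.ne')
    refine (hcon.continuousAt (hopen.mem_nhds hmem)).congr ?_
    filter_upwards [hopen.mem_nhds hmem] with w hw
    have h2 := hC (a z + relAngle (a z) w) ‖w‖ (norm_nonneg w)
    rw [polarProj_add_relAngle hw] at h2
    exact h2.symm

lemma frontier_ball_zero {r : ℝ} (hr : 0 < r) :
    frontier (Metric.ball (0 : Plane) r) = Metric.sphere 0 r := frontier_ball 0 hr.ne'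

lemma exists_polarProj_of_mem_sphere {r : ℝ} {w : Plane} (hw : w ∈ Metric.sphere (0 : Plane) r) :
    ∃ φ, polarProj φ r = w := by
  obtain ⟨φ, hφ⟩ := exists_polarProj_norm w
  rw [mem_sphere_zero_iff_norm] at hw
  rw [hw] at hφ
  exact ⟨φ, hφ⟩

lemma abs_zero_le_norm (z : Plane) : |z 0| ≤ ‖z‖ := PiLp.norm_apply_le z 0

/-- The degree is zero when the first component has constant sign `σ` on the circle: a suitable
smooth approximation of the homogeneous extension has no zeros at all. -/
theorem hasPolarDegree_zero {f : ℝ → ℝ → Plane} {r : ℝ} (hr : 0 < r)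
    (hc : Continuous (fun φ => f φ r)) (hper : ∀ φ, f (φ + 2 * Real.pi) r = f φ r) {σ : ℝ}
    (hσ : |σ| = 1) (hpos : ∀ φ, 0 < σ * f φ r 0) : HasPolarDegree f r 0 := by
  have hσσ : σ * σ = 1 := by rw [← abs_mul_abs_self, hσ, one_mul]
  obtain ⟨m, hm, hmf⟩ : ∃ m > 0, ∀ φ, m ≤ σ * f φ r 0 := by
    have hK := Function.Periodic.compact_of_continuous (f := fun φ => f φ r) (c := 2 * Real.pi)
      hper (by positivity) hc
    obtain ⟨m, hm, h⟩ := hK.exists_forall_le' (f := fun z : Plane => σ * z 0) (a := 0)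
      (by fun_prop) (by rintro _ ⟨φ, rfl⟩; exact hpos φ)
    exact ⟨m, hm, fun φ => h _ (mem_range_self φ)⟩
  obtain ⟨C, hCc, hC⟩ := exists_homogeneous_extension hc hper
  set G : Plane → Plane := fun z => r⁻¹ • C z with hG
  have hGc : Continuous G := hCc.const_smul r⁻¹
  have hGp : ∀ φ s, 0 ≤ s → G (polarProj φ s) = (s / r) • f φ r := fun φ s hs => by
    simp only [hG, hC φ s hs, smul_smul, div_eq_inv_mul]
  have hG0 : ∀ z, 0 ≤ σ * G z 0 := fun z => by
    obtain ⟨φ, hφ⟩ := exists_polarProj_norm z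
    rw [← hφ, hGp φ _ (norm_nonneg z), PiLp.smul_apply, smul_eq_mul, mul_left_comm]
    exact mul_nonneg (by positivity) (hpos φ).le
  have hGr : ∀ φ, G (polarProj φ r) = f φ r := fun φ => by
    rw [hGp φ r hr.le, div_self hr.ne', one_smul]
  have hGm : ∀ w ∈ Metric.sphere (0 : Plane) r, m ≤ ‖G w‖ := fun w hw => by
    obtain ⟨φ, rfl⟩ := exists_polarProj_of_mem_sphere hw
    rw [hGr]
    calc m ≤ σ * f φ r 0 := hmf φ
      _ ≤ |σ * f φ r 0| := le_abs_self _
      _ = |f φ r 0| := by rw [abs_mul, hσ, one_mul]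
      _ ≤ ‖f φ r‖ := abs_zero_le_norm _
  -- shift the extension in the direction of the first component, then smooth it
  obtain ⟨g, hg, hgG, -⟩ := Continuous.exists_contDiff_approx (E := Plane) (F := Plane)
    (f := fun z => G z + !₂[σ * (m / 2), 0]) (ε := fun _ => m / 4) 1
    (hGc.add continuous_const) continuous_const (fun _ => by positivity)
  have hshift : ‖(!₂[σ * (m / 2), 0] : Plane)‖ = m / 2 := by
    rw [EuclideanSpace.norm_eq, Fin.sum_univ_two]
    simp [hσ, abs_of_pos hm, Real.sqrt_sq (half_pos hm).le]
  have hclose : ∀ x, ‖g x - G x‖ < m := fun x => by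
    have h1 := hgG x
    rw [dist_eq_norm] at h1
    have h2 : g x - G x = (g x - (G x + !₂[σ * (m / 2), 0])) + !₂[σ * (m / 2), 0] := by abel
    rw [h2]
    refine (norm_add_le _ _).trans_lt ?_
    rw [hshift]
    linarith
  have hg0 : ∀ x, g x ≠ 0 := fun x hx => by
    have h1 := hgG x
    rw [dist_eq_norm, hx] at h1
    have h2 := (abs_zero_le_norm _).trans_lt h1
    simp only [zero_sub, PiLp.neg_apply, PiLp.add_apply, abs_neg, Matrix.cons_val_zero] at h2
    have h3 : |σ * (G x 0 + σ * (m / 2))| < m / 4 := by rw [abs_mul, hσ, one_mul]; exact h2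
    have h4 : σ * (G x 0 + σ * (m / 2)) = σ * G x 0 + m / 2 := by
      linear_combination (m / 2) * hσσ
    rw [h4] at h3
    linarith [hG0 x, le_abs_self (σ * G x 0 + m / 2)]
  refine ⟨hr, fun φ h0 => ?_, fun φ s => (s / r) • f φ r, G, ?_, ?_, ?_, ?_, hGp, ?_⟩
  · have := hpos φ
    rw [h0] at this
    simp at this
  · have : Continuous (fun q : ℝ × ℝ => (q.2 / r) • f q.1 r) :=
      (continuous_snd.div_const r).smul (hc.comp continuous_fst)
    exact this.continuousOn
  · intro φ s _
    simp only [hper]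
  · simp
  · simp [hr.ne']
  · refine ⟨Metric.isOpen_ball, Metric.isBounded_ball, hGc.continuousOn, ?_, g, ∅, hg,
      ?_, ?_, ?_, ?_⟩
    · rintro ⟨w, hw, hw0⟩
      rw [frontier_ball_zero hr] at hw
      have := hGm w hw
      rw [hw0, norm_zero] at this
      linarith
    · intro x _ w hw
      rw [frontier_ball_zero hr] at hw
      rw [zero_sub, norm_neg]
      exact (hclose x).trans_le (hGm w hw)
    · intro x
      simp [hg0 x]
    · simp
    · simp

/-- In the coordinates `(a, b)` of the basis `(u, v)`, which has determinant `1`, this is the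
quadratic map `(a b, k (a² - b²))`; on the plane it has degree `-2`. -/
def quadMap (k : ℝ) (u v z : Plane) : Plane :=
  !₂[(z 0 * v 1 - z 1 * v 0) * (u 0 * z 1 - u 1 * z 0),
    k * ((z 0 * v 1 - z 1 * v 0) ^ 2 - (u 0 * z 1 - u 1 * z 0) ^ 2)]

lemma quadMap_smul (k c : ℝ) (u v z : Plane) :
    quadMap k u v (c • z) = c ^ 2 • quadMap k u v z := by
  refine plane_ext ?_ ?_ <;>
  · simp only [quadMap, PiLp.smul_apply, smul_eq_mul, Matrix.cons_val_zero, Matrix.cons_val_one,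
      Matrix.cons_val_fin_one]
    ring

lemma contDiff_toPlane {E : Type*} [NormedAddCommGroup E] [NormedSpace ℝ E] {f g : E → ℝ}
    {n : ℕ∞} (hf : ContDiff ℝ n f) (hg : ContDiff ℝ n g) :
    ContDiff ℝ n (fun x => (!₂[f x, g x] : Plane)) := by
  rw [contDiff_euclidean]
  intro i
  fin_cases i <;> simpa

lemma contDiff_quadMap (k : ℝ) (u v : Plane) {n : ℕ∞} : ContDiff ℝ n (quadMap k u v) := by
  have h : ∀ i, ContDiff ℝ n (fun z : Plane => z i) := fun i =>
    (EuclideanSpace.proj (𝕜 := ℝ) i).contDiff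
  refine contDiff_toPlane ?_ ?_
  · exact (((h 0).mul contDiff_const).sub ((h 1).mul contDiff_const)).mul
      ((contDiff_const.mul (h 1)).sub (contDiff_const.mul (h 0)))
  · exact contDiff_const.mul ((((h 0).mul contDiff_const).sub ((h 1).mul contDiff_const)).pow 2
      |>.sub (((contDiff_const.mul (h 1)).sub (contDiff_const.mul (h 0))).pow 2))

lemma det_act (N : Mat) : (act N).det = N.det := by
  rw [ContinuousLinearMap.det, act, Matrix.coe_toEuclideanCLM_eq_toEuclideanLin,
    Matrix.toEuclideanLin_eq_toLin_orthonormal, LinearMap.det_toLin]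

/-- The Jacobian determinant of `quadMap`. -/
lemma det_fderiv_quadMap {k : ℝ} {u v : Plane} (huv : u 0 * v 1 - u 1 * v 0 = 1) (z : Plane) :
    (fderiv ℝ (quadMap k u v) z).det
      = -2 * k * ((z 0 * v 1 - z 1 * v 0) ^ 2 + (u 0 * z 1 - u 1 * z 0) ^ 2) := by
  set a := z 0 * v 1 - z 1 * v 0 with ha
  set b := u 0 * z 1 - u 1 * z 0 with hb
  have hcoord : ∀ i, HasFDerivAt (fun z : Plane => z i) (EuclideanSpace.proj (𝕜 := ℝ) i) z :=
    fun i => (EuclideanSpace.proj (𝕜 := ℝ) i).hasFDerivAt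
  have hA := ((hcoord 0).mul_const (v 1)).sub ((hcoord 1).mul_const (v 0))
  have hB := ((hcoord 1).const_mul (u 0)).sub ((hcoord 0).const_mul (u 1))
  have hd : HasFDerivAt (quadMap k u v)
      (act !![a * -u 1 + b * v 1, a * u 0 - b * v 0;
        2 * k * (a * v 1 + b * u 1), 2 * k * (-(a * v 0) - b * u 0)]) z := by
    rw [← hasFDerivWithinAt_univ, hasFDerivWithinAt_euclidean]
    intro i
    fin_cases i
    · rw [hasFDerivWithinAt_univ]
      refine (hA.mul hB).congr_fderiv ?_
      ext w
      simp [act_zero]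
      ring
    · rw [hasFDerivWithinAt_univ]
      refine (((hA.pow 2).sub (hB.pow 2)).const_mul k).congr_fderiv ?_
      ext w
      simp [act_one]
      ring
  rw [hd.fderiv, det_act, Matrix.det_fin_two]
  simp only [Matrix.of_apply, Matrix.cons_val', Matrix.cons_val_zero, Matrix.cons_val_one,
    Matrix.cons_val_fin_one]
  linear_combination (-2 * k * (a ^ 2 + b ^ 2)) * huv

/-- The degree is `-2` when the curve is joined to `quadMap` by segments avoiding the origin. The
extension of the curve is taken equal to `quadMap` near the origin, where it can be perturbed to
have exactly two zeros, both with negative Jacobian determinant. -/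
theorem hasPolarDegree_neg_two {f : ℝ → ℝ → Plane} {r k : ℝ} (hr : 0 < r) (hk : 0 < k)
    {u v : Plane} (huv : u 0 * v 1 - u 1 * v 0 = 1) (hc : Continuous (fun φ => f φ r))
    (hper : ∀ φ, f (φ + 2 * Real.pi) r = f φ r)
    (hne : ∀ φ, ∀ t ∈ Icc (0 : ℝ) 1, (1 - t) • f φ r + t • quadMap k u v (unitVec φ) ≠ 0) :
    HasPolarDegree f r (-2) := by
  have hqc : Continuous (quadMap k u v) := (contDiff_quadMap k u v (n := 0)).continuous
  -- a lower bound on the segments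
  obtain ⟨m, hm, hmf⟩ : ∃ m > 0, ∀ φ, ∀ t ∈ Icc (0 : ℝ) 1,
      m ≤ ‖(1 - t) • f φ r + t • quadMap k u v (unitVec φ)‖ := by
    have hK := Function.Periodic.compact_of_continuous
      (f := fun φ => (f φ r, quadMap k u v (unitVec φ))) (c := 2 * Real.pi)
      (fun φ => by simp only [hper, unitVec_add_two_pi]) (by positivity)
      (hc.prodMk (hqc.comp continuous_unitVec))
    obtain ⟨m, hm, h⟩ := (hK.prod (isCompact_Icc (a := (0 : ℝ)) (b := 1))).exists_forall_le'
      (f := fun x => ‖(1 - x.2) • x.1.1 + x.2 • x.1.2‖) (a := 0)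
      (Continuous.continuousOn (by fun_prop)) (by
        rintro ⟨_, t⟩ ⟨⟨φ, rfl⟩, ht⟩
        exact norm_pos_iff.2 (hne φ t ht))
    exact ⟨m, hm, fun φ t ht => h ((f φ r, quadMap k u v (unitVec φ)), t)
      ⟨mem_range_self φ, ht⟩⟩
  have hcone : ∀ φ α β, 0 ≤ α → 0 ≤ β → (α + β) * m
      ≤ ‖α • f φ r + β • quadMap k u v (unitVec φ)‖ := by
    intro φ α β hα hβ
    rcases (add_nonneg hα hβ).eq_or_lt with h0 | h0
    · rw [← h0, zero_mul]
      exact norm_nonneg _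
    · have h1 := hmf φ (β / (α + β)) ⟨by positivity, by rw [div_le_one h0]; linarith⟩
      have h2 : α • f φ r + β • quadMap k u v (unitVec φ) = (α + β) •
          ((1 - β / (α + β)) • f φ r + (β / (α + β)) • quadMap k u v (unitVec φ)) := by
        rw [smul_add, smul_smul, smul_smul]
        congr 2 <;> field_simp
        ring
      rw [h2, norm_smul, Real.norm_of_nonneg h0.le]
      exact mul_le_mul_of_nonneg_left h1 h0.le
  -- the extension of the curve: it is `quadMap` up to the radius `r / 2`, where `χ` vanishes, and
  -- the cutoff `χ` is `1` at the radius `r`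
  obtain ⟨C, hCc, hC⟩ := exists_homogeneous_extension hc hper
  set χ : ℝ → ℝ := fun s => max 0 (min 1 (2 * (s / r) - 1)) with hχ
  have hχc : Continuous χ := by
    simp only [hχ]
    fun_prop
  have hχ0 : ∀ s, 0 ≤ χ s := fun s => le_max_left _ _
  have hχ1 : ∀ s, χ s ≤ 1 := fun s => max_le zero_le_one (min_le_left _ _)
  have hχr : χ r = 1 := by simp [hχ, hr.ne']; norm_num
  have hχz : ∀ s, s ≤ r / 2 → χ s = 0 := fun s hs => by
    have : s / r ≤ 1 / 2 := by rw [div_le_iff₀ hr]; linarith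
    exact max_eq_left ((min_le_right _ _).trans (by linarith))
  set f' : ℝ → ℝ → Plane := fun φ s => (χ s * (s / r)) • f φ r
    + ((1 - χ s) * (s / r) ^ 2) • quadMap k u v (unitVec φ) with hf'
  set G : Plane → Plane := fun z => χ ‖z‖ • r⁻¹ • C z
    + (1 - χ ‖z‖) • quadMap k u v (r⁻¹ • z) with hG
  have hGc : Continuous G := by
    have h1 : Continuous (fun z : Plane => χ ‖z‖) := hχc.comp continuous_norm
    exact (h1.smul (hCc.const_smul r⁻¹)).add
      ((continuous_const.sub h1).smul (hqc.comp (continuous_const_smul r⁻¹)))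
  have hGp : ∀ φ s, 0 ≤ s → G (polarProj φ s) = f' φ s := fun φ s hs => by
    simp only [hG, hf', norm_polarProj hs, hC φ s hs]
    rw [polarProj_eq_smul, smul_smul, smul_smul, smul_smul, quadMap_smul, smul_smul]
    simp only [div_eq_inv_mul, mul_assoc]
  have hGr : ∀ φ, G (polarProj φ r) = f φ r := fun φ => by
    rw [hGp φ r hr.le]
    simp [hf', hχr, hr.ne']
  have hGm : ∀ w ∈ Metric.sphere (0 : Plane) r, m ≤ ‖G w‖ := fun w hw => by
    obtain ⟨φ, rfl⟩ := exists_polarProj_of_mem_sphere hw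
    rw [hGr]
    simpa using hmf φ 0 (by simp)
  have hGout : ∀ z : Plane, r / 4 ≤ ‖z‖ → ‖z‖ ≤ r → m / 16 ≤ ‖G z‖ := fun z hz1 hz2 => by
    obtain ⟨φ, hφ⟩ := exists_polarProj_norm z
    rw [← hφ, hGp φ _ (norm_nonneg z)]
    set s := ‖z‖ / r with hs
    have hs1 : 1 / 4 ≤ s := by rw [hs, le_div_iff₀ hr]; linarith
    have hs2 : s ≤ 1 := by rw [hs, div_le_one hr]; exact hz2
    refine le_trans ?_ (hcone φ _ _ (mul_nonneg (hχ0 _) (by linarith))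
      (mul_nonneg (sub_nonneg.2 (hχ1 _)) (sq_nonneg s)))
    have h1 : s ^ 2 ≤ s := by nlinarith
    have h2 : χ ‖z‖ * s ^ 2 ≤ χ ‖z‖ * s := mul_le_mul_of_nonneg_left h1 (hχ0 _)
    have h3 : 1 / 16 ≤ s ^ 2 := by nlinarith
    have h4 : 1 / 16 ≤ χ ‖z‖ * s + (1 - χ ‖z‖) * s ^ 2 := by linarith
    calc m / 16 = 1 / 16 * m := by ring
      _ ≤ _ := mul_le_mul_of_nonneg_right h4 hm.le
  -- `ε` is so small that the zeros lie well inside the region where the extension is `quadMap`,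
  -- and that the perturbation is smaller than the extension outside
  obtain ⟨ε, hε, hεu, hεm⟩ : ∃ ε > 0, ε * ‖u‖ < 1 / 4 ∧ k * ε ^ 2 < m / 32 := by
    have h1 : Tendsto (fun ε : ℝ => ε * ‖u‖) (𝓝[>] 0) (𝓝 0) := by
      have : Continuous (fun ε : ℝ => ε * ‖u‖) := by fun_prop
      simpa using (this.tendsto 0).mono_left nhdsWithin_le_nhds
    have h2 : Tendsto (fun ε : ℝ => k * ε ^ 2) (𝓝[>] 0) (𝓝 0) := by
      have : Continuous (fun ε : ℝ => k * ε ^ 2) := by fun_prop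
      simpa using (this.tendsto 0).mono_left nhdsWithin_le_nhds
    obtain ⟨ε, h⟩ := ((eventually_mem_nhdsWithin).and
      ((h1.eventually (gt_mem_nhds (show (0 : ℝ) < 1 / 4 by norm_num))).and
        (h2.eventually (gt_mem_nhds (show 0 < m / 32 by positivity))))).exists
    exact ⟨ε, h.1, h.2.1, h.2.2⟩
  set κ : Plane := !₂[0, k * ε ^ 2] with hκ
  have hκn : ‖κ‖ = k * ε ^ 2 := by
    rw [hκ, EuclideanSpace.norm_eq, Fin.sum_univ_two]
    simp [Real.sqrt_sq (show 0 ≤ k * ε ^ 2 by positivity), abs_of_pos hk]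
  have hGin : ∀ z : Plane, ‖z‖ ≤ r / 2 → G z = quadMap k u v (r⁻¹ • z) := fun z hz => by
    simp [hG, hχz _ hz]
  have hsmooth : ContDiff ℝ 1 (fun z : Plane => quadMap k u v (r⁻¹ • z) - κ) :=
    ((contDiff_quadMap k u v (n := 1)).comp (contDiff_id.const_smul r⁻¹)).sub contDiff_const
  obtain ⟨g, hg, hgG, hgS, -⟩ := Continuous.exists_contDiff_approx_and_eqOn (E := Plane)
    (F := Plane) (f := fun z => G z - κ) (ε := fun _ => m / 32) 1
    (hGc.sub continuous_const) continuous_const (fun _ => by positivity)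
    (S := Metric.closedBall 0 (r / 4)) (U := Metric.ball 0 (r / 2)) Metric.isClosed_closedBall
    (Metric.isOpen_ball.mem_nhdsSet.2 (Metric.closedBall_subset_ball (by linarith)))
    (hsmooth.contDiffOn.congr fun z hz => by
      rw [hGin z (mem_ball_zero_iff.1 hz).le])
  have hclose : ∀ x, ‖g x - G x‖ < m / 16 := fun x => by
    have h1 := hgG x
    rw [dist_eq_norm] at h1
    have h2 : g x - G x = (g x - (G x - κ)) - κ := by abel
    rw [h2]
    refine (norm_sub_le _ _).trans_lt ?_
    rw [hκn]
    linarith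
  have hgin : ∀ z : Plane, ‖z‖ ≤ r / 4 → g z = quadMap k u v (r⁻¹ • z) - κ := fun z hz => by
    rw [hgS (mem_closedBall_zero_iff.2 hz)]
    simp only
    rw [hGin z (by linarith)]
  have hu : u ≠ 0 := by
    rintro rfl
    simp at huv
  set z₀ : Plane := (r * ε) • u with hz₀
  have hz₀n : ‖z₀‖ < r / 4 := by
    rw [hz₀, norm_smul, Real.norm_of_nonneg (by positivity), mul_assoc]
    calc r * (ε * ‖u‖) < r * (1 / 4) := mul_lt_mul_of_pos_left hεu hr
      _ = r / 4 := by ring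
  have hz₀0 : z₀ ≠ 0 := smul_ne_zero (by positivity) hu
  have hscale : r⁻¹ • z₀ = ε • u := by
    rw [hz₀, smul_smul]
    congr 1
    field_simp
  have hval : ∀ c : ℝ, c ^ 2 = ε ^ 2 → quadMap k u v (c • u) = κ := fun c hcε => by
    refine plane_ext ?_ ?_
    · simp [quadMap, hκ]
      right
      ring
    · simp only [quadMap, hκ, PiLp.smul_apply, smul_eq_mul, Matrix.cons_val_one,
        Matrix.cons_val_fin_one]
      rw [← hcε]
      linear_combination k * c ^ 2 * (u 0 * v 1 - u 1 * v 0 + 1) * huv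
  have hzero : ∀ x : Plane, ‖x‖ ≤ r / 4 → (g x = 0 ↔ x = z₀ ∨ x = -z₀) := by
    intro x hx
    rw [hgin x hx, sub_eq_zero]
    constructor
    · intro h
      set y := r⁻¹ • x with hy
      have hxy : x = r • y := by rw [hy, smul_inv_smul₀ hr.ne']
      set a := y 0 * v 1 - y 1 * v 0 with ha
      set b := u 0 * y 1 - u 1 * y 0 with hb
      have e0 : a * b = 0 := by
        have := congrArg (fun w : Plane => w 0) h
        simpa [quadMap, hκ] using this
      have e1 : k * (a ^ 2 - b ^ 2) = k * ε ^ 2 := by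
        have := congrArg (fun w : Plane => w 1) h
        simpa [quadMap, hκ] using this
      have e2 : a ^ 2 - b ^ 2 = ε ^ 2 := mul_left_cancel₀ hk.ne' e1
      have hb0 : b = 0 := by
        rcases mul_eq_zero.1 e0 with ha0 | hb0
        · rw [ha0] at e2
          have := pow_pos hε 2
          nlinarith [sq_nonneg b]
        · exact hb0
      have hyu : y = a • u := by
        refine plane_ext ?_ ?_
        · simp only [PiLp.smul_apply, smul_eq_mul]
          linear_combination (-(y 0)) * huv + v 0 * (hb.symm.trans hb0) + u 0 * ha
        · simp only [PiLp.smul_apply, smul_eq_mul]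
          linear_combination (-(y 1)) * huv + v 1 * (hb.symm.trans hb0) + u 1 * ha
      rw [hb0] at e2
      have ha2 : (a - ε) * (a + ε) = 0 := by linear_combination e2
      rcases mul_eq_zero.1 ha2 with h1 | h1
      · left
        rw [hxy, hyu, show a = ε by linarith, smul_smul]
      · right
        rw [hxy, hyu, show a = -ε by linarith, smul_smul, hz₀, ← neg_smul]
        congr 1
        ring
    · rintro (rfl | rfl)
      · rw [hscale, hval ε rfl]
      · rw [smul_neg, hscale, ← neg_smul, hval (-ε) (by ring)]
  have hdet : ∀ x, x = z₀ ∨ x = -z₀ → (fderiv ℝ g x).det < 0 := by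
    intro x hx
    have hxn : ‖x‖ < r / 4 := by
      rcases hx with rfl | rfl
      · exact hz₀n
      · rwa [norm_neg]
    have hloc : g =ᶠ[𝓝 x] fun z => quadMap k u v (r⁻¹ • z) - κ := by
      filter_upwards [Metric.isOpen_ball.mem_nhds (mem_ball_zero_iff.2 hxn)] with z hz
      exact hgin z (mem_ball_zero_iff.1 hz).le
    have hr2 : ∀ z : Plane, quadMap k u v (r⁻¹ • z) = (r⁻¹) ^ 2 • quadMap k u v z := fun z =>
      quadMap_smul k r⁻¹ u v z
    have hqd : DifferentiableAt ℝ (quadMap k u v) x :=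
      (contDiff_quadMap k u v (n := 1)).differentiable one_ne_zero x
    have hfd : fderiv ℝ g x = (r⁻¹) ^ 2 • fderiv ℝ (quadMap k u v) x := by
      rw [hloc.fderiv_eq]
      simp only [hr2]
      rw [fderiv_sub_const]
      exact fderiv_fun_const_smul hqd _
    have hne2 : 0 < (x 0 * v 1 - x 1 * v 0) ^ 2 + (u 0 * x 1 - u 1 * x 0) ^ 2 := by
      have h1 : (x 0 * v 1 - x 1 * v 0) ^ 2 = (r * ε) ^ 2 := by
        rcases hx with rfl | rfl
        · simp only [hz₀, PiLp.smul_apply, smul_eq_mul]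
          linear_combination (r * ε) ^ 2 * (u 0 * v 1 - u 1 * v 0 + 1) * huv
        · simp only [hz₀, PiLp.smul_apply, PiLp.neg_apply, smul_eq_mul]
          linear_combination (r * ε) ^ 2 * (u 0 * v 1 - u 1 * v 0 + 1) * huv
      rw [h1]
      positivity
    have hsm : ((r⁻¹) ^ 2 • fderiv ℝ (quadMap k u v) x).det
        = ((r⁻¹) ^ 2) ^ 2 * (fderiv ℝ (quadMap k u v) x).det := by
      rw [ContinuousLinearMap.det, ContinuousLinearMap.det, ContinuousLinearMap.toLinearMap_smul,
        LinearMap.det_smul]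
      simp
    rw [hfd, hsm, det_fderiv_quadMap huv]
    have : 0 < r⁻¹ := inv_pos.2 hr
    refine mul_neg_of_pos_of_neg (by positivity) ?_
    nlinarith [mul_pos hk hne2]
  have hzz : z₀ ≠ -z₀ := fun h => by
    rw [eq_neg_iff_add_eq_zero, ← two_smul ℝ] at h
    exact hz₀0 ((smul_eq_zero.1 h).resolve_left two_ne_zero)
  refine ⟨hr, fun φ h0 => hne φ 0 (by simp) (by simp [h0]), f', G, ?_, ?_, ?_, ?_, hGp, ?_⟩
  · have h1 : Continuous (fun q : ℝ × ℝ => G (polarProj q.1 q.2)) :=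
      hGc.comp continuous_polarProj
    exact h1.continuousOn.congr fun q hq => (hGp q.1 q.2 hq.2).symm
  · intro φ s _
    simp only [hf', hper, unitVec_add_two_pi]
  · intro φ
    simp [hf']
  · intro φ
    rw [← hGp φ r hr.le, hGr]
  · refine ⟨Metric.isOpen_ball, Metric.isBounded_ball, hGc.continuousOn, ?_, g, {z₀, -z₀}, hg,
      ?_, ?_, ?_, ?_⟩
    · rintro ⟨w, hw, hw0⟩
      rw [frontier_ball_zero hr] at hw
      have := hGm w hw
      rw [hw0, norm_zero] at this
      linarith
    · intro x _ w hw
      rw [frontier_ball_zero hr] at hw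
      rw [zero_sub, norm_neg]
      linarith [hclose x, hGm w hw]
    · intro x
      rw [Finset.mem_insert, Finset.mem_singleton]
      constructor
      · intro hx
        have hxn : ‖x‖ < r / 4 := by
          rcases hx with rfl | rfl
          · exact hz₀n
          · rwa [norm_neg]
        exact ⟨mem_ball_zero_iff.2 (by linarith), (hzero x hxn.le).2 hx⟩
      · rintro ⟨hx, hx0⟩
        rw [mem_ball_zero_iff] at hx
        by_cases hx4 : ‖x‖ ≤ r / 4
        · exact (hzero x hx4).1 hx0
        · have h1 := hclose x
          rw [hx0, zero_sub, norm_neg] at h1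
          linarith [hGout x (by linarith) hx.le]
    · intro x hx
      rw [Finset.mem_insert, Finset.mem_singleton] at hx
      exact (hdet x hx).ne
    · rw [Finset.sum_pair hzz, sign_neg (hdet z₀ (Or.inl rfl)), sign_neg (hdet (-z₀) (Or.inr rfl))]
      rfl

/-! ### Rotation bounds for the linear system -/

lemma trace_hyp_mul_rot (τ σ θ : ℝ) :
    (hyp τ σ * rot θ).trace = 2 * Real.cosh τ * Real.cos θ := by
  simp only [Matrix.trace_fin_two, Matrix.mul_apply, Fin.sum_univ_two, hyp, rot, Matrix.of_apply,
    Matrix.cons_val', Matrix.cons_val_zero, Matrix.cons_val_one, Matrix.cons_val_fin_one]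
  ring

/-- A continuous function on `[x, y]` that omits the values `a` and `b` and ends between them
starts between them. -/
lemma mem_Ioo_of_forall_ne {d : ℝ → ℝ} {a b x y : ℝ} (hxy : x ≤ y)
    (hd : ContinuousOn d (Icc x y)) (hne : ∀ s ∈ Icc x y, d s ≠ a ∧ d s ≠ b)
    (hy : a < d y ∧ d y < b) : a < d x ∧ d x < b := by
  constructor
  · by_contra hcon
    obtain ⟨s, hs, h⟩ := intermediate_value_Icc hxy hd ⟨not_lt.1 hcon, hy.1.le⟩
    exact (hne s hs).1 h
  · by_contra hcon
    obtain ⟨s, hs, h⟩ := intermediate_value_Icc' hxy hd ⟨hy.2.le, not_lt.1 hcon⟩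
    exact (hne s hs).2 h

/-- A symplectic path on `[0, T + 1]` with rotation angle `θ`, all of whose values on `[T, T + 1]`
are nonresonant, and which makes `i` counter-clockwise half-windings. -/
structure IsProlongedPath (T : ℝ) (Ψ : ℝ → Mat) (θ : ℝ → ℝ) (i : ℤ) : Prop where
  continuousOn : ContinuousOn Ψ (Icc 0 (T + 1))
  symplectic : ∀ s ∈ Icc 0 (T + 1), IsSymplectic (Ψ s)
  nonresonant : ∀ s ∈ Icc T (T + 1), (1 - Ψ s).det ≠ 0
  angle : IsRotationAngle (T + 1) Ψ θ
  angle_end : -θ (T + 1) = i * Real.pi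

namespace IsProlongedPath

variable {T : ℝ} {Ψ : ℝ → Mat} {θ : ℝ → ℝ} {i : ℤ}

lemma det_eq_one (h : IsProlongedPath T Ψ θ i) {s : ℝ} (hs : s ∈ Icc 0 (T + 1)) :
    (Ψ s).det = 1 := (h.symplectic s hs).det_eq_one

lemma trace_ne_two (h : IsProlongedPath T Ψ θ i) (hT : 0 < T) {s : ℝ}
    (hs : s ∈ Icc T (T + 1)) : (Ψ s).trace ≠ 2 := fun h2 => by
  apply h.nonresonant s hs
  rw [det_one_sub (h.det_eq_one ⟨hT.le.trans hs.1, hs.2⟩), h2, sub_self]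

lemma continuousOn_trace (h : IsProlongedPath T Ψ θ i) (hT : 0 < T) {s : ℝ}
    (hs : s ∈ Icc T (T + 1)) : ContinuousOn (fun s => (Ψ s).trace) (Icc s (T + 1)) :=
  (continuous_id.matrix_trace.comp_continuousOn h.continuousOn).mono
    (Icc_subset_Icc_left (hT.le.trans hs.1))

/-- For an odd index the trace is at most `-2` at the end of the path, and it never equals `2` on
`[T, T + 1]`. -/
lemma trace_lt_two (h : IsProlongedPath T Ψ θ i) (hT : 0 < T) {l : ℤ} (hi : i = 2 * l + 1) {s : ℝ}
    (hs : s ∈ Icc T (T + 1)) : (Ψ s).trace < 2 := by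
  have hend : (Ψ (T + 1)).trace < 2 := by
    obtain ⟨τ, σ, -, hd⟩ := h.angle.decomp (T + 1) (right_mem_Icc.2 (by linarith))
    have h1 : θ (T + 1) = -(l * (2 * Real.pi) + Real.pi) := by
      have := h.angle_end
      rw [hi] at this
      push_cast at this
      linarith
    rw [hd, trace_hyp_mul_rot, h1, Real.cos_neg, Real.cos_int_mul_two_pi_add_pi]
    linarith [Real.cosh_pos τ]
  by_contra hcon
  obtain ⟨x, hx, h1⟩ := intermediate_value_Icc' hs.2 (h.continuousOn_trace hT hs)
    ⟨hend.le, not_lt.1 hcon⟩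
  exact h.trace_ne_two hT ⟨hs.1.trans hx.1, hx.2⟩ h1

/-- For an even index the trace is at least `2` at the end of the path, and it never equals `2` on
`[T, T + 1]`. -/
lemma two_lt_trace (h : IsProlongedPath T Ψ θ i) (hT : 0 < T) {l : ℤ} (hi : i = 2 * l) {s : ℝ}
    (hs : s ∈ Icc T (T + 1)) : 2 < (Ψ s).trace := by
  have hend : 2 ≤ (Ψ (T + 1)).trace := by
    obtain ⟨τ, σ, -, hd⟩ := h.angle.decomp (T + 1) (right_mem_Icc.2 (by linarith))
    have h1 : θ (T + 1) = -(l * (2 * Real.pi)) := by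
      have := h.angle_end
      rw [hi] at this
      push_cast at this
      linarith
    rw [hd, trace_hyp_mul_rot, h1, Real.cos_neg, Real.cos_int_mul_two_pi]
    linarith [Real.one_le_cosh τ]
  by_contra hcon
  obtain ⟨x, hx, h1⟩ := intermediate_value_Icc hs.2 (h.continuousOn_trace hT hs)
    ⟨not_lt.1 hcon, hend⟩
  exact h.trace_ne_two hT ⟨hs.1.trans hx.1, hx.2⟩ h1

lemma norm_act_pos (h : IsProlongedPath T Ψ θ i) (φ : ℝ) {s : ℝ} (hs : s ∈ Icc 0 (T + 1)) :
    0 < ‖act (Ψ s) (unitVec φ)‖ :=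
  norm_pos_iff.2 (act_ne_zero (h.det_eq_one hs) (unitVec_ne_zero φ))

/-- For traces less than `2` there are no positive eigenvalues, so no vector turns by a multiple
of `2 π`. -/
lemma linAngle_sub_ne_even (h : IsProlongedPath T Ψ θ i) {s : ℝ} (hs : s ∈ Icc 0 (T + 1))
    (htr : (Ψ s).trace < 2) (φ : ℝ) (k : ℤ) :
    linAngle Ψ θ φ s - φ ≠ ((2 * k : ℤ) : ℝ) * Real.pi := by
  intro hk
  have hR := h.norm_act_pos φ hs
  have h1 := h.angle.act_eq_smul hs hk
  have hcos : Real.cos (((2 * k : ℤ) : ℝ) * Real.pi) = 1 := by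
    rw [show ((2 * k : ℤ) : ℝ) * Real.pi = k * (2 * Real.pi) by push_cast; ring,
      Real.cos_int_mul_two_pi]
  rw [hcos, one_mul] at h1
  set R := ‖act (Ψ s) (unitVec φ)‖
  rw [trace_eq_of_act_eq_smul (h.det_eq_one hs) (unitVec_ne_zero φ) hR.ne' h1] at htr
  have h2 : R * R⁻¹ = 1 := mul_inv_cancel₀ hR.ne'
  nlinarith [sq_nonneg (R - R⁻¹), inv_pos.2 hR]

/-- For traces greater than `2` there are no negative eigenvalues, so no vector turns by an odd
multiple of `π`. -/
lemma linAngle_sub_ne_odd (h : IsProlongedPath T Ψ θ i) {s : ℝ} (hs : s ∈ Icc 0 (T + 1))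
    (htr : 2 < (Ψ s).trace) (φ : ℝ) (k : ℤ) :
    linAngle Ψ θ φ s - φ ≠ ((2 * k + 1 : ℤ) : ℝ) * Real.pi := by
  intro hk
  have hR := h.norm_act_pos φ hs
  have h1 := h.angle.act_eq_smul hs hk
  have hcos : Real.cos (((2 * k + 1 : ℤ) : ℝ) * Real.pi) = -1 := by
    rw [show ((2 * k + 1 : ℤ) : ℝ) * Real.pi = k * (2 * Real.pi) + Real.pi by push_cast; ring,
      Real.cos_int_mul_two_pi_add_pi]
  rw [hcos, neg_one_mul] at h1
  set R := ‖act (Ψ s) (unitVec φ)‖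
  rw [trace_eq_of_act_eq_smul (h.det_eq_one hs) (unitVec_ne_zero φ) (neg_ne_zero.2 hR.ne') h1,
    inv_neg] at htr
  linarith [inv_pos.2 hR]

lemma continuousOn_linAngle_sub (h : IsProlongedPath T Ψ θ i) (hT : 0 < T) (φ : ℝ) :
    ContinuousOn (fun s => -(linAngle Ψ θ φ s - φ)) (Icc T (T + 1)) :=
  (((h.angle.continuousOn_linAngle h.continuousOn φ).mono
    (Icc_subset_Icc_left hT.le)).sub continuousOn_const).neg

lemma rotation_odd (h : IsProlongedPath T Ψ θ i) (hT : 0 < T) {l : ℤ} (hi : i = 2 * l + 1)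
    (φ : ℝ) : 2 * l * Real.pi < -(linAngle Ψ θ φ T - φ) ∧
      -(linAngle Ψ θ φ T - φ) < 2 * (l + 1) * Real.pi := by
  refine mem_Ioo_of_forall_ne (d := fun s => -(linAngle Ψ θ φ s - φ)) (y := T + 1) (by linarith)
    (h.continuousOn_linAngle_sub hT φ) (fun s hs => ?_) ?_
  · have hs' : s ∈ Icc 0 (T + 1) := ⟨hT.le.trans hs.1, hs.2⟩
    have h1 := fun k => h.linAngle_sub_ne_even hs' (h.trace_lt_two hT hi hs) φ k
    constructor
    · intro h2
      apply h1 (-l)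
      push_cast
      linarith
    · intro h2
      apply h1 (-(l + 1))
      push_cast
      linarith
  · have h1 := abs_lt.1 (abs_linAngle_sub_lt (Ψ := Ψ) (θ := θ) φ (T + 1))
    have h2 := h.angle_end
    rw [hi] at h2
    push_cast at h2
    constructor <;> nlinarith [Real.pi_pos, h1.1, h1.2]

lemma rotation_even (h : IsProlongedPath T Ψ θ i) (hT : 0 < T) {l : ℤ} (hi : i = 2 * l)
    (φ : ℝ) : (2 * l - 1) * Real.pi < -(linAngle Ψ θ φ T - φ) ∧
      -(linAngle Ψ θ φ T - φ) < (2 * l + 1) * Real.pi := by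
  refine mem_Ioo_of_forall_ne (d := fun s => -(linAngle Ψ θ φ s - φ)) (y := T + 1) (by linarith)
    (h.continuousOn_linAngle_sub hT φ) (fun s hs => ?_) ?_
  · have hs' : s ∈ Icc 0 (T + 1) := ⟨hT.le.trans hs.1, hs.2⟩
    have h1 := fun k => h.linAngle_sub_ne_odd hs' (h.two_lt_trace hT hi hs) φ k
    constructor
    · intro h2
      apply h1 (-l)
      push_cast
      linarith
    · intro h2
      apply h1 (-l - 1)
      push_cast
      linarith
  · have h1 := abs_lt.1 (abs_linAngle_sub_lt (Ψ := Ψ) (θ := θ) φ (T + 1))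
    have h2 := h.angle_end
    rw [hi] at h2
    push_cast at h2
    constructor <;> nlinarith [Real.pi_pos, h1.1, h1.2]

end IsProlongedPath

/-! ### Hyperbolic matrices and the quadratic model -/

lemma exists_eigenvector {M : Mat} {c : ℝ} (hc : c ^ 2 - M.trace * c + 1 = 0) (hM : M.det = 1) :
    ∃ u : Plane, u ≠ 0 ∧ act M u = c • u := by
  have hdet : (M - c • (1 : Mat)).det = 0 := by
    rw [Matrix.det_fin_two] at hM ⊢
    rw [Matrix.trace_fin_two] at hc
    simp
    linarith
  obtain ⟨x, hx, h⟩ := Matrix.exists_mulVec_eq_zero_iff.2 hdet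
  refine ⟨WithLp.toLp 2 x, fun h0 => hx ?_, ?_⟩
  · simpa using h0
  · have h0 := congrFun h 0
    have h1 := congrFun h 1
    simp [Matrix.mulVec, dotProduct, Fin.sum_univ_two] at h0 h1
    refine plane_ext ?_ ?_
    · rw [act_zero]
      simp
      linarith
    · rw [act_one]
      simp
      linarith

/-- A matrix with determinant `1` and trace greater than `2` is diagonalised, with eigenvalues
`c > 1` and `c⁻¹`, in a basis of determinant `1`. -/
lemma exists_eigenbasis {M : Mat} (hM : M.det = 1) (htr : 2 < M.trace) :
    ∃ (c : ℝ) (u v : Plane), 1 < c ∧ u 0 * v 1 - u 1 * v 0 = 1 ∧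
      act M u = c • u ∧ act M v = c⁻¹ • v := by
  set q := M.trace with hq
  set c := (q + √(q ^ 2 - 4)) / 2 with hc
  have hdisc : 0 < q ^ 2 - 4 := by nlinarith
  have hsq : √(q ^ 2 - 4) ^ 2 = q ^ 2 - 4 := Real.sq_sqrt hdisc.le
  have hspos : 0 < √(q ^ 2 - 4) := Real.sqrt_pos.2 hdisc
  have hc1 : 1 < c := by rw [hc]; linarith
  have hroot : c ^ 2 - q * c + 1 = 0 := by
    rw [hc]
    linear_combination (1 / 4) * hsq
  have hc0 : c ≠ 0 := by positivity
  have hroot' : c⁻¹ ^ 2 - q * c⁻¹ + 1 = 0 := by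
    field_simp
    linarith
  obtain ⟨u, hu, hMu⟩ := exists_eigenvector hroot hM
  obtain ⟨v, hv, hMv⟩ := exists_eigenvector hroot' hM
  have hcc : c⁻¹ < c := (inv_lt_one_of_one_lt₀ hc1).trans hc1
  have hD : u 0 * v 1 - u 1 * v 0 ≠ 0 := by
    intro hD
    have hne : c - c⁻¹ ≠ 0 := (sub_pos.2 hcc).ne'
    have key : ∀ x y : ℝ, x • v = y • u → x = 0 := by
      intro x y hxy
      have h1 := congrArg (act M) hxy
      rw [map_smul, map_smul, hMu, hMv, smul_comm y, ← hxy, smul_comm x, ← sub_eq_zero,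
        ← sub_smul, smul_smul] at h1
      have h2 := (smul_eq_zero.1 h1).resolve_right hv
      rw [← neg_sub, neg_mul, neg_eq_zero] at h2
      exact (mul_eq_zero.1 h2).resolve_left hne
    refine hu (plane_ext (key (u 0) (v 0) (plane_ext ?_ ?_)) (key (u 1) (v 1) (plane_ext ?_ ?_)))
      <;> simp only [PiLp.smul_apply, smul_eq_mul] <;> linarith
  refine ⟨c, u, (u 0 * v 1 - u 1 * v 0)⁻¹ • v, hc1, ?_, hMu, ?_⟩
  · simp only [PiLp.smul_apply, smul_eq_mul]
    field_simp
  · rw [map_smul, hMv, smul_comm]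

/-- The displacement `(α, ‖M z‖ - 1)` of a unit vector `z` in polar coordinates is joined to the
quadratic model in eigencoordinates by a segment avoiding the origin: the first components have
the same sign, and where they vanish, at the eigenvectors, so do the second ones. -/
lemma segment_quadMap_ne_zero {M : Mat} {c : ℝ} {u v : Plane} (hc : 1 < c)
    (huv : u 0 * v 1 - u 1 * v 0 = 1) (hu : act M u = c • u) (hv : act M v = c⁻¹ • v)
    {φ α : ℝ} (hα : |α| < Real.pi) (hR : 0 < ‖act M (unitVec φ)‖)
    (h : polarProj (φ + α) ‖act M (unitVec φ)‖ = act M (unitVec φ)) {t : ℝ}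
    (ht : t ∈ Icc (0 : ℝ) 1) :
    (1 - t) • (!₂[α, ‖act M (unitVec φ)‖ - 1] : Plane) + t • quadMap 1 u v (unitVec φ) ≠ 0 := by
  set e := unitVec φ with he
  set R := ‖act M e‖ with hRdef
  set a := e 0 * v 1 - e 1 * v 0 with ha
  set b := u 0 * e 1 - u 1 * e 0 with hb
  have hcc : 0 < c - c⁻¹ := sub_pos.2 ((inv_lt_one_of_one_lt₀ hc).trans hc)
  have hdec : e = a • u + b • v := by
    refine plane_ext ?_ ?_
    · simp only [PiLp.add_apply, PiLp.smul_apply, smul_eq_mul]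
      linear_combination (-(e 0)) * huv + u 0 * ha + v 0 * hb
    · simp only [PiLp.add_apply, PiLp.smul_apply, smul_eq_mul]
      linear_combination (-(e 1)) * huv + u 1 * ha + v 1 * hb
  have hMe : act M e = (c * a) • u + (c⁻¹ * b) • v := by
    conv_lhs => rw [hdec]
    rw [map_add, map_smul, map_smul, hu, hv, smul_smul, smul_smul, mul_comm a, mul_comm b]
  have hsin : a * b * (c - c⁻¹) = R * Real.sin α := by
    have h1 := frameIm_polarProj φ (φ + α) R
    rw [h, add_sub_cancel_left] at h1
    rw [← h1]
    have h2 : frameIm φ (act M e) = act M e 0 * e 1 - act M e 1 * e 0 := by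
      rw [frameIm, he, unitVec_zero, unitVec_one]; ring
    have e0 : act M e 0 = c * a * u 0 + c⁻¹ * b * v 0 := by rw [hMe]; rfl
    have e1 : act M e 1 = c * a * u 1 + c⁻¹ * b * v 1 := by rw [hMe]; rfl
    rw [h2, e0, e1]
    linear_combination c * a * hb - c⁻¹ * b * ha
  have hπ := abs_lt.1 hα
  intro h0
  have c0 : (1 - t) * α + t * (a * b) = 0 := by
    have := congrArg (fun w : Plane => w 0) h0
    simpa [quadMap] using this
  have c1 : (1 - t) * (R - 1) + t * (a ^ 2 - b ^ 2) = 0 := by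
    have := congrArg (fun w : Plane => w 1) h0
    simpa [quadMap] using this
  have ht0 := ht.1
  have ht1 : 0 ≤ 1 - t := sub_nonneg.2 ht.2
  have hconv : ∀ x y : ℝ, 0 < x → 0 < y → 0 < (1 - t) * x + t * y := by
    intro x y hx hy
    rcases ht0.eq_or_lt with h2 | h2
    · rw [← h2]; linarith
    · have := mul_pos h2 hy
      have := mul_nonneg ht1 hx.le
      linarith
  have hen : ‖e‖ = 1 := norm_unitVec φ
  rcases lt_trichotomy (a * b) 0 with hab | hab | hab
  · have hs : Real.sin α < 0 := by
      by_contra hcon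
      nlinarith [mul_nonneg hR.le (not_lt.1 hcon), mul_neg_of_neg_of_pos hab hcc]
    have hα0 : α < 0 := by
      by_contra hcon
      linarith [Real.sin_nonneg_of_nonneg_of_le_pi (not_lt.1 hcon) hπ.2.le]
    linarith [hconv (-α) (-(a * b)) (by linarith) (by linarith)]
  · rcases mul_eq_zero.1 hab with ha0 | hb0
    · have hb2 : 0 < b ^ 2 := by
        refine lt_of_le_of_ne (sq_nonneg b) fun hb2 => ?_
        have hb0 : b = 0 := pow_eq_zero_iff two_ne_zero |>.1 hb2.symm
        rw [hdec, ha0, hb0] at hen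
        simp at hen
      have hRc : R = c⁻¹ := by
        have h1 : act M e = c⁻¹ • e := by
          rw [hMe, ha0]
          conv_rhs => rw [hdec, ha0]
          simp [smul_smul]
        rw [hRdef, h1, norm_smul, hen, mul_one, Real.norm_of_nonneg (by positivity)]
      rw [hRc, ha0] at c1
      linarith [hconv (1 - c⁻¹) (b ^ 2) (sub_pos.2 (inv_lt_one_of_one_lt₀ hc)) hb2]
    · have ha2 : 0 < a ^ 2 := by
        refine lt_of_le_of_ne (sq_nonneg a) fun ha2 => ?_
        have ha0 : a = 0 := pow_eq_zero_iff two_ne_zero |>.1 ha2.symm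
        rw [hdec, ha0, hb0] at hen
        simp at hen
      have hRc : R = c := by
        have h1 : act M e = c • e := by
          rw [hMe, hb0]
          conv_rhs => rw [hdec, hb0]
          simp [smul_smul]
        rw [hRdef, h1, norm_smul, hen, mul_one, Real.norm_of_nonneg (by positivity)]
      rw [hRc, hb0] at c1
      linarith [hconv (c - 1) (a ^ 2) (by linarith) ha2]
  · have hs : 0 < Real.sin α := by
      by_contra hcon
      nlinarith [mul_nonneg hR.le (neg_nonneg.2 (not_lt.1 hcon)), mul_pos hab hcc]
    have hα0 : 0 < α := by
      by_contra hcon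
      linarith [Real.sin_nonpos_of_nonpos_of_neg_pi_le (not_lt.1 hcon) hπ.1.le]
    linarith [hconv α (a * b) hα0 hab]

/-! ### The displacement of the Hamiltonian system -/

section Displacement

variable {T : ℝ} {H : ℝ → Plane → ℝ}

lemma IsRegularHamiltonian.exists_isSolution (hH : IsRegularHamiltonian T H) (hT : 0 ≤ T)
    (z₀ : Plane) : ∃ z : ℝ → Plane, z 0 = z₀ ∧ IsSolution T H z := by
  obtain ⟨K, hK⟩ := hH.lipschitz_field
  exact exists_solution_of_lipschitz hK hH.continuous_field_time hT z₀

lemma IsRegularHamiltonian.solution_unique (hH : IsRegularHamiltonian T H) {z w : ℝ → Plane}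
    (hz : IsSolution T H z) (hw : IsSolution T H w) (h0 : z 0 = w 0) {t : ℝ} (ht : t ∈ Icc 0 T) :
    z t = w t := by
  obtain ⟨K, hK⟩ := hH.lipschitz_field
  have h := dist_solution_le hK hz hw ht
  rw [h0, dist_self, zero_mul] at h
  exact dist_le_zero.1 h

/-- Lifted trajectories are unique at the final time, so any of them computes the lifted Poincaré
map. -/
lemma IsLiftedTrajectory.poincareLift_eq (hH : IsRegularHamiltonian T H) (hT : 0 ≤ T) {φ r : ℝ}
    {p : ℝ → ℝ × ℝ} (hp : IsLiftedTrajectory T H φ r p) : poincareLift T H φ r = p T := by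
  have hex : ∃ p, IsLiftedTrajectory T H φ r p := ⟨p, hp⟩
  rw [poincareLift, dif_pos hex]
  set q := hex.choose with hq
  have hqs : IsLiftedTrajectory T H φ r q := hex.choose_spec
  have heq : ∀ t ∈ Icc 0 T, polarProj (q t).1 (q t).2 = polarProj (p t).1 (p t).2 := fun t ht =>
    hH.solution_unique (z := fun s => polarProj (q s).1 (q s).2)
      (w := fun s => polarProj (p s).1 (p s).2) hqs.solution hp.solution
      (by simp only [hqs.init, hp.init]) ht
  have hTm : T ∈ Icc 0 T := right_mem_Icc.2 hT
  refine Prod.ext ?_ ?_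
  · exact angle_unique hT hqs.continuousOn hp.continuousOn hqs.pos hp.pos heq
      (by rw [hqs.init, hp.init])
  · rw [← norm_polarProj (hqs.pos T hTm).le, heq T hTm, norm_polarProj (hp.pos T hTm).le]

/-- A solution that stays within a right angle of a continuous reference angle `a` lifts to polar
coordinates. -/
lemma IsSolution.isLiftedTrajectory {z : ℝ → Plane} (hz : IsSolution T H z) {φ r : ℝ} (hr : 0 ≤ r)
    (hz0 : z 0 = polarProj φ r) {a : ℝ → ℝ} (ha : ContinuousOn a (Icc 0 T)) (ha0 : a 0 = φ)
    (hpos : ∀ t ∈ Icc 0 T, 0 < frameRe (a t) (z t)) :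
    IsLiftedTrajectory T H φ r (fun t => (a t + relAngle (a t) (z t), ‖z t‖)) := by
  have hzc : ContinuousOn z (Icc 0 T) := fun t ht => (hz t ht).continuousWithinAt
  have hpz : ∀ t ∈ Icc 0 T, polarProj (a t + relAngle (a t) (z t)) ‖z t‖ = z t := fun t ht =>
    polarProj_add_relAngle (hpos t ht)
  refine ⟨?_, ?_, fun t ht => ?_, fun t ht => ?_⟩
  · simp only [ha0, hz0, norm_polarProj hr, relAngle, frameIm_polarProj, sub_self, Real.sin_zero,
      mul_zero, zero_div, Real.arctan_zero, add_zero]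
  · exact (ha.add (continuousOn_relAngle ha hzc fun t ht => (hpos t ht).ne')).prodMk hzc.norm
  · exact (hpos t ht).trans_le ((le_abs_self _).trans (abs_frameRe_le _ _))
  · simp only
    rw [hpz t ht]
    exact (hz t ht).congr (fun s hs => hpz s hs) (hpz t ht)

variable {Ψ : ℝ → Mat} {θ : ℝ → ℝ} {i : ℤ}

/-- The images of unit vectors under a path of symplectic matrices stay away from zero. -/
lemma IsProlongedPath.exists_le_norm_act (h : IsProlongedPath T Ψ θ i) :
    ∃ κ > 0, ∀ t ∈ Icc 0 T, ∀ φ, κ ≤ ‖act (Ψ t) (unitVec φ)‖ := by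
  have hK := Function.Periodic.compact_of_continuous (f := unitVec) (c := 2 * Real.pi)
    unitVec_add_two_pi (by positivity) continuous_unitVec
  have hsub : Icc 0 T ⊆ Icc 0 (T + 1) := Icc_subset_Icc_right (by linarith)
  have hc : ContinuousOn (fun q : ℝ × Plane => ‖act (Ψ q.1) q.2‖) (Icc 0 T ×ˢ range unitVec) := by
    refine ContinuousOn.norm (ContinuousOn.clm_apply ?_ continuousOn_snd)
    exact continuous_act.comp_continuousOn ((h.continuousOn.mono hsub).comp continuousOn_fst
      fun q hq => hq.1)
  obtain ⟨κ, hκ, hb⟩ := (isCompact_Icc.prod hK).exists_forall_le' hc (a := 0) (by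
    rintro ⟨t, _⟩ ⟨ht, ⟨φ, rfl⟩⟩
    exact h.norm_act_pos φ (hsub ht))
  exact ⟨κ, hκ, fun t ht φ => hb (t, unitVec φ) ⟨ht, mem_range_self φ⟩⟩

/-- Along the filter of radii the displacement is defined, continuous and periodic, its angular
component tends uniformly to that of the linear system, and so does its radial component divided
by the radius. -/
theorem IsAsymptoticallyLinearAlong.eventually_displacement (hT : 0 < T)
    (hH : IsRegularHamiltonian T H) {A Φ : ℝ → Mat} {l : Filter ℝ} [l.IsCountablyGenerated]
    (hA : IsAsymptoticallyLinearAlong T H A l) (hΦ : IsFundamentalMatrix T A Φ)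
    (h : IsProlongedPath T Ψ θ i) (hΨΦ : EqOn Ψ Φ (Icc 0 T)) {μ : ℝ} (hμ : 0 < μ) :
    ∀ᶠ r in l, 0 < r ∧ (∀ φ, ∃ p, IsLiftedTrajectory T H φ r p) ∧
      Continuous (fun φ => displacement T H φ r) ∧
      (∀ φ, displacement T H (φ + 2 * Real.pi) r = displacement T H φ r) ∧
      ∀ φ, |displacement T H φ r 0 - (linAngle Ψ θ φ T - φ)| ≤ μ ∧
        |displacement T H φ r 1 - r * (‖act (Ψ T) (unitVec φ)‖ - 1)| ≤ r * μ := by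
  obtain ⟨κ, hκ, hκb⟩ := h.exists_le_norm_act
  -- an error `η` in a vector of length at least `κ` changes its angle by at most `η / (κ - η)`
  set η : ℝ := min (κ / 2) (min μ (κ * μ / 2)) with hη
  have hη0 : 0 < η := lt_min (half_pos hκ) (lt_min hμ (by positivity))
  have hη1 : η ≤ κ / 2 := min_le_left _ _
  have hη2 : η ≤ μ := (min_le_right _ _).trans (min_le_left _ _)
  have hη3 : η ≤ κ * μ / 2 := (min_le_right _ _).trans (min_le_right _ _)
  have hsub : Icc 0 T ⊆ Icc 0 (T + 1) := Icc_subset_Icc_right (by linarith)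
  have hTm : T ∈ Icc 0 T := right_mem_Icc.2 hT.le
  filter_upwards [hA.pos, hA.eventually_norm_sub_le hT hH hΦ hη0] with r hr hclose
  choose z hz0 hz using fun φ => hH.exists_isSolution hT.le (polarProj φ r)
  have hnear : ∀ φ, ∀ t ∈ Icc 0 T, ‖r⁻¹ • z φ t - act (Ψ t) (unitVec φ)‖ ≤ η := by
    intro φ t ht
    have h1 := hclose (z φ) (hz φ) (by rw [hz0, norm_polarProj hr.le]) t ht
    rwa [hz0, polarProj_eq_smul, inv_smul_smul₀ hr.ne', ← hΨΦ ht] at h1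
  have hlinRe : ∀ φ, ∀ t ∈ Icc 0 T, frameRe (linAngle Ψ θ φ t) (act (Ψ t) (unitVec φ))
      = ‖act (Ψ t) (unitVec φ)‖ := fun φ t ht => by
    have h1 := frameRe_polarProj (linAngle Ψ θ φ t) (linAngle Ψ θ φ t) ‖act (Ψ t) (unitVec φ)‖
    rwa [h.angle.polarProj_linAngle φ (hsub ht), sub_self, Real.cos_zero, mul_one] at h1
  have hlinIm : ∀ φ, ∀ t ∈ Icc 0 T, frameIm (linAngle Ψ θ φ t) (act (Ψ t) (unitVec φ)) = 0 :=
    fun φ t ht => by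
    have h1 := frameIm_polarProj (linAngle Ψ θ φ t) (linAngle Ψ θ φ t) ‖act (Ψ t) (unitVec φ)‖
    rwa [h.angle.polarProj_linAngle φ (hsub ht), sub_self, Real.sin_zero, mul_zero] at h1
  have hRe : ∀ φ, ∀ t ∈ Icc 0 T, κ / 2 ≤ frameRe (linAngle Ψ θ φ t) (r⁻¹ • z φ t) := by
    intro φ t ht
    have h1 := (abs_frameRe_le (linAngle Ψ θ φ t) _).trans (hnear φ t ht)
    rw [frameRe_sub, hlinRe φ t ht, abs_le] at h1
    linarith [hκb t ht φ, h1.1]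
  have hIm : ∀ φ, ∀ t ∈ Icc 0 T, |frameIm (linAngle Ψ θ φ t) (r⁻¹ • z φ t)| ≤ η := by
    intro φ t ht
    have h1 := (abs_frameIm_le (linAngle Ψ θ φ t) _).trans (hnear φ t ht)
    rwa [frameIm_sub, hlinIm φ t ht, sub_zero] at h1
  have hpos : ∀ φ, ∀ t ∈ Icc 0 T, 0 < frameRe (linAngle Ψ θ φ t) (z φ t) := by
    intro φ t ht
    have h1 := hRe φ t ht
    rw [frameRe_smul] at h1
    exact pos_of_mul_pos_right (lt_of_lt_of_le (by positivity) h1) (inv_pos.2 hr).le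
  have hinit : ∀ φ, linAngle Ψ θ φ 0 = φ :=
    h.angle.linAngle_zero ((hΨΦ (left_mem_Icc.2 hT.le)).trans hΦ.init)
  have hlift : ∀ φ, IsLiftedTrajectory T H φ r
      (fun t => (linAngle Ψ θ φ t + relAngle (linAngle Ψ θ φ t) (z φ t), ‖z φ t‖)) := fun φ =>
    (hz φ).isLiftedTrajectory hr.le (hz0 φ)
      ((h.angle.continuousOn_linAngle h.continuousOn φ).mono hsub) (hinit φ) (hpos φ)
  have hdisp : ∀ φ, displacement T H φ r = !₂[linAngle Ψ θ φ T
      + relAngle (linAngle Ψ θ φ T) (z φ T) - φ, ‖z φ T‖ - r] := fun φ => by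
    rw [displacement, (hlift φ).poincareLift_eq hH hT.le]
  have hzc : Continuous (fun φ => z φ T) := by
    obtain ⟨K, hK⟩ := hH.lipschitz_field
    rw [continuous_iff_continuousAt]
    intro φ
    have h1 : Continuous (fun ψ => dist (polarProj ψ r) (polarProj φ r) * Real.exp (K * T)) := by
      have : Continuous (fun ψ => polarProj ψ r) :=
        continuous_polarProj.comp (by fun_prop : Continuous (fun ψ : ℝ => (ψ, r)))
      fun_prop
    have h2 := h1.tendsto φ
    rw [dist_self, zero_mul] at h2
    rw [ContinuousAt, tendsto_iff_dist_tendsto_zero]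
    refine squeeze_zero (fun _ => dist_nonneg) (fun ψ => ?_) h2
    have h3 := dist_solution_le hK (hz ψ) (hz φ) hTm
    rwa [hz0, hz0] at h3
  have hzper : ∀ φ, z (φ + 2 * Real.pi) T = z φ T := fun φ =>
    hH.solution_unique (hz _) (hz _) (by rw [hz0, hz0, polarProj_add_two_pi]) hTm
  refine ⟨hr, fun φ => ⟨_, hlift φ⟩, ?_, fun φ => ?_, fun φ => ⟨?_, ?_⟩⟩
  · have hl := h.angle.continuous_linAngle (hsub hTm)
    have h1 : Continuous (fun φ => relAngle (linAngle Ψ θ φ T) (z φ T)) :=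
      continuousOn_univ.1 (continuousOn_relAngle hl.continuousOn hzc.continuousOn
        fun φ _ => (hpos φ T hTm).ne')
    simp only [hdisp]
    exact continuous_toPlane ((hl.add h1).sub continuous_id) (hzc.norm.sub continuous_const)
  · rw [hdisp, hdisp, linAngle_add_two_pi, relAngle_add_two_pi, hzper]
    refine plane_ext ?_ rfl
    simp only [Matrix.cons_val_zero]
    ring
  · have h1 : displacement T H φ r 0 - (linAngle Ψ θ φ T - φ)
        = relAngle (linAngle Ψ θ φ T) (z φ T) := by
      rw [hdisp]
      simp only [Matrix.cons_val_zero]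
      ring
    rw [h1, ← relAngle_smul _ (inv_ne_zero hr.ne')]
    refine (abs_arctan_le _).trans ?_
    have h2 := hRe φ T hTm
    have h3 := hIm φ T hTm
    rw [abs_div, abs_of_pos (lt_of_lt_of_le (half_pos hκ) h2),
      div_le_iff₀ (lt_of_lt_of_le (half_pos hκ) h2)]
    have h4 := mul_le_mul_of_nonneg_left h2 hμ.le
    linarith
  · have h1 : displacement T H φ r 1 - r * (‖act (Ψ T) (unitVec φ)‖ - 1)
        = r * (‖r⁻¹ • z φ T‖ - ‖act (Ψ T) (unitVec φ)‖) := by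
      rw [hdisp, norm_smul, Real.norm_of_nonneg (inv_nonneg.2 hr.le)]
      simp only [Matrix.cons_val_one, Matrix.cons_val_fin_one]
      field_simp
      ring
    rw [h1, abs_mul, abs_of_pos hr]
    exact mul_le_mul_of_nonneg_left
      ((abs_norm_sub_norm_le _ _).trans ((hnear φ T hTm).trans hη2)) hr.le

end Displacement

/-! ### Rotation and degree -/

/-- A continuous periodic function strictly between `a` and `b` keeps a distance from both. -/
lemma exists_margin {d : ℝ → ℝ} (hd : Continuous d) (hper : ∀ φ, d (φ + 2 * Real.pi) = d φ)
    {a b : ℝ} (h : ∀ φ, a < d φ ∧ d φ < b) : ∃ μ > 0, ∀ φ, a + μ ≤ d φ ∧ d φ ≤ b - μ := by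
  have hK := Function.Periodic.compact_of_continuous (f := d) (c := 2 * Real.pi) hper
    (by positivity) hd
  obtain ⟨μ, hμ, hb⟩ := hK.exists_forall_le' (f := fun x => min (x - a) (b - x)) (a := 0)
    (by fun_prop) (by
      rintro _ ⟨φ, rfl⟩
      exact lt_min (sub_pos.2 (h φ).1) (sub_pos.2 (h φ).2))
  refine ⟨μ, hμ, fun φ => ?_⟩
  have := hb _ (mem_range_self φ)
  rw [le_min_iff] at this
  constructor <;> linarith [this.1, this.2]

section Core

variable {T : ℝ} {H : ℝ → Plane → ℝ} {r : ℝ}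

/-- The translate of the displacement by `(2 M π, 0)` has degree zero if its first component has
constant sign. -/
lemma hasPolarDegree_displacement_zero (hr : 0 < r)
    (hc : Continuous (fun φ => displacement T H φ r))
    (hper : ∀ φ, displacement T H (φ + 2 * Real.pi) r = displacement T H φ r) {M : ℤ} {σ : ℝ}
    (hσ : |σ| = 1) (hpos : ∀ φ, 0 < σ * (displacement T H φ r 0 + 2 * M * Real.pi)) :
    HasPolarDegree (fun φ s => displacement T H φ s + !₂[2 * (M : ℝ) * Real.pi, 0]) r 0 := by
  refine hasPolarDegree_zero hr (hc.add continuous_const) (fun φ => ?_) hσ (fun φ => ?_)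
  · simp only [hper]
  · simpa using hpos φ

/-- The degree is zero if the values of `-F₁` lie in an open interval that omits `2 M π`. -/
lemma hasPolarDegree_displacement_zero_of_bounds (hr : 0 < r)
    (hc : Continuous (fun φ => displacement T H φ r))
    (hper : ∀ φ, displacement T H (φ + 2 * Real.pi) r = displacement T H φ r) {M : ℤ} {a b : ℝ}
    (hab : ∀ φ, a < -(displacement T H φ r 0) ∧ -(displacement T H φ r 0) < b)
    (hM : 2 * M * Real.pi ≤ a ∨ b ≤ 2 * M * Real.pi) :
    HasPolarDegree (fun φ s => displacement T H φ s + !₂[2 * (M : ℝ) * Real.pi, 0]) r 0 := by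
  rcases hM with hM | hM
  · refine hasPolarDegree_displacement_zero hr hc hper (σ := -1) (by simp) fun φ => ?_
    linarith [(hab φ).1]
  · refine hasPolarDegree_displacement_zero hr hc hper (σ := 1) (by simp) fun φ => ?_
    linarith [(hab φ).2]

variable {A Φ Ψ : ℝ → Mat} {θ : ℝ → ℝ} {l : Filter ℝ} [l.IsCountablyGenerated]

lemma IsProlongedPath.continuous_neg_linAngle {i : ℤ} (h : IsProlongedPath T Ψ θ i) (hT : 0 < T) :
    Continuous (fun φ => -(linAngle Ψ θ φ T - φ)) :=
  ((h.angle.continuous_linAngle ⟨hT.le, by linarith⟩).sub continuous_id).neg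

/-- For an odd index the angular displacement stays strictly between consecutive multiples of
`2 π`, by compactness uniformly for the linear system, so every degree vanishes. -/
theorem eventually_hasRotationAndDegree_odd (hT : 0 < T) (hH : IsRegularHamiltonian T H)
    (hA : IsAsymptoticallyLinearAlong T H A l) (hΦ : IsFundamentalMatrix T A Φ) {k : ℤ}
    (h : IsProlongedPath T Ψ θ (2 * k + 1)) (hΨΦ : EqOn Ψ Φ (Icc 0 T)) :
    ∀ᶠ r in l, HasRotationAndDegree T H r (2 * k + 1) := by
  obtain ⟨μ, hμ, hb⟩ := exists_margin (h.continuous_neg_linAngle hT)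
    (fun φ => by rw [linAngle_add_two_pi]; ring) (h.rotation_odd hT rfl)
  filter_upwards [hA.eventually_displacement hT hH hΦ h hΨΦ (half_pos hμ)]
    with r ⟨hr, hlift, hc, hper, hclose⟩
  have hrot : ∀ φ, 2 * k * Real.pi < -(displacement T H φ r 0) ∧
      -(displacement T H φ r 0) < 2 * (k + 1) * Real.pi := fun φ => by
    have h1 := abs_le.1 (hclose φ).1
    have h2 := hb φ
    constructor <;> linarith [h1.1, h1.2, h2.1, h2.2]
  refine ⟨hlift, fun m hm φ => ?_, fun m hm => ?_, fun M => ?_⟩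
  · rw [show m = k by omega]
    exact hrot φ
  · omega
  · rw [if_neg (by omega)]
    refine hasPolarDegree_displacement_zero_of_bounds hr hc hper hrot ?_
    rcases le_or_gt M k with hMk | hMk
    · left
      have : (M : ℝ) ≤ k := by exact_mod_cast hMk
      have := mul_le_mul_of_nonneg_right this Real.pi_pos.le
      linarith
    · right
      have : (k : ℝ) + 1 ≤ M := by exact_mod_cast hMk
      have := mul_le_mul_of_nonneg_right this Real.pi_pos.le
      linarith

/-- For an even index `2 k` the angular displacement can vanish modulo `2 π`, at `-2 k π` only. The
translate by `2 k π` is joined to the quadratic model by segments avoiding the origin; this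
transfers from the linear displacement by compactness, and is invariant under the scaling of the
radial component by `r`. -/
theorem eventually_hasRotationAndDegree_even (hT : 0 < T) (hH : IsRegularHamiltonian T H)
    (hA : IsAsymptoticallyLinearAlong T H A l) (hΦ : IsFundamentalMatrix T A Φ) {k : ℤ}
    (h : IsProlongedPath T Ψ θ (2 * k)) (hΨΦ : EqOn Ψ Φ (Icc 0 T)) :
    ∀ᶠ r in l, HasRotationAndDegree T H r (2 * k) := by
  have hT1 : T ∈ Icc T (T + 1) := left_mem_Icc.2 (by linarith)
  have hT0 : T ∈ Icc 0 (T + 1) := ⟨hT.le, by linarith⟩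
  obtain ⟨μ, hμ, hb⟩ := exists_margin (h.continuous_neg_linAngle hT)
    (fun φ => by rw [linAngle_add_two_pi]; ring) (h.rotation_even hT rfl)
  obtain ⟨c, u, v, hc1, huv, hu, hv⟩ := exists_eigenbasis (h.det_eq_one hT0)
    (h.two_lt_trace hT rfl hT1)
  -- the linear displacement with radius `1`, and its distance to the quadratic model
  set lin : ℝ → Plane := fun φ =>
    !₂[linAngle Ψ θ φ T - φ + 2 * k * Real.pi, ‖act (Ψ T) (unitVec φ)‖ - 1] with hlin
  have hlinc : Continuous lin :=
    continuous_toPlane (((h.angle.continuous_linAngle hT0).sub continuous_id).add continuous_const)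
      ((((act (Ψ T)).continuous.comp continuous_unitVec).norm).sub continuous_const)
  have hqc : Continuous (fun φ => quadMap 1 u v (unitVec φ)) :=
    ((contDiff_quadMap 1 u v (n := 0)).continuous).comp continuous_unitVec
  have hseg : ∀ φ, ∀ t ∈ Icc (0 : ℝ) 1,
      (1 - t) • lin φ + t • quadMap 1 u v (unitVec φ) ≠ 0 := by
    intro φ t ht
    refine segment_quadMap_ne_zero hc1 huv hu hv ?_ (h.norm_act_pos φ hT0) ?_ ht
    · have := h.rotation_even hT rfl φ
      rw [abs_lt]
      constructor <;> linarith [this.1, this.2]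
    · have h1 := h.angle.polarProj_linAngle φ hT0
      have h2 : φ + (linAngle Ψ θ φ T - φ + 2 * k * Real.pi)
          = linAngle Ψ θ φ T + k * (2 * Real.pi) := by ring
      have h3 : Function.Periodic (fun ψ => polarProj ψ ‖act (Ψ T) (unitVec φ)‖) (2 * Real.pi) :=
        fun ψ => polarProj_add_two_pi ψ _
      rw [h2]
      exact (h3.int_mul k _).trans h1
  obtain ⟨ν, hν, hνb⟩ : ∃ ν > 0, ∀ φ, ∀ t ∈ Icc (0 : ℝ) 1,
      ν ≤ ‖(1 - t) • lin φ + t • quadMap 1 u v (unitVec φ)‖ := by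
    have hK := Function.Periodic.compact_of_continuous
      (f := fun φ => (lin φ, quadMap 1 u v (unitVec φ))) (c := 2 * Real.pi)
      (fun φ => by
        simp only [hlin, unitVec_add_two_pi, linAngle_add_two_pi]
        congr 4
        ring) (by positivity) (hlinc.prodMk hqc)
    obtain ⟨ν, hν, hb⟩ := (hK.prod (isCompact_Icc (a := (0 : ℝ)) (b := 1))).exists_forall_le'
      (f := fun x => ‖(1 - x.2) • x.1.1 + x.2 • x.1.2‖) (a := 0)
      (Continuous.continuousOn (by fun_prop)) (by
        rintro ⟨_, t⟩ ⟨⟨φ, rfl⟩, ht⟩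
        exact norm_pos_iff.2 (hseg φ t ht))
    exact ⟨ν, hν, fun φ t ht => hb ((lin φ, quadMap 1 u v (unitVec φ)), t)
      ⟨mem_range_self φ, ht⟩⟩
  have hδ : 0 < min (μ / 2) (ν / 4) := lt_min (half_pos hμ) (by positivity)
  filter_upwards [hA.eventually_displacement hT hH hΦ h hΨΦ hδ]
    with r ⟨hr, hlift, hc, hper, hclose⟩
  have hrot : ∀ φ, (2 * k - 1) * Real.pi < -(displacement T H φ r 0) ∧
      -(displacement T H φ r 0) < (2 * k + 1) * Real.pi := fun φ => by
    have h1 := abs_le.1 ((hclose φ).1.trans (min_le_left _ _))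
    have h2 := hb φ
    constructor <;> linarith [h1.1, h1.2, h2.1, h2.2]
  refine ⟨hlift, fun m hm => ?_, fun m hm φ => ?_, fun M => ?_⟩
  · omega
  · rw [show m = k by omega]
    exact hrot φ
  · by_cases hMk : 2 * k = 2 * M
    · rw [if_pos hMk, ← show k = M by omega]
      refine hasPolarDegree_neg_two hr (k := r) hr huv (hc.add continuous_const)
        (fun φ => by simp only [hper]) fun φ t ht h0 => ?_
      -- division of the second component by `r` gives a vector near the segment from `lin φ`
      have h1 := abs_le.1 ((hclose φ).1.trans (min_le_right _ _))
      have h2 := abs_le.1 ((hclose φ).2.trans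
        (mul_le_mul_of_nonneg_left (min_le_right _ _) hr.le))
      have c0 := congrArg (fun w : Plane => w 0) h0
      have c1 := congrArg (fun w : Plane => w 1) h0
      simp only [PiLp.add_apply, PiLp.smul_apply, smul_eq_mul, quadMap, Matrix.cons_val_zero,
        Matrix.cons_val_one, Matrix.cons_val_fin_one, PiLp.zero_apply, add_zero] at c0 c1
      have ht1 : 0 ≤ 1 - t := sub_nonneg.2 ht.2
      have ht1' : 1 - t ≤ 1 := by linarith [ht.1]
      set X := (1 - t) • lin φ + t • quadMap 1 u v (unitVec φ) with hX
      have hX0 : X 0 = -((1 - t) * (displacement T H φ r 0 - (linAngle Ψ θ φ T - φ))) := by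
        simp only [hX, hlin, PiLp.add_apply, PiLp.smul_apply, smul_eq_mul, quadMap,
          Matrix.cons_val_zero]
        linear_combination c0
      have hX1 : r * X 1 = -((1 - t) * (displacement T H φ r 1
          - r * (‖act (Ψ T) (unitVec φ)‖ - 1))) := by
        simp only [hX, hlin, PiLp.add_apply, PiLp.smul_apply, smul_eq_mul, quadMap,
          Matrix.cons_val_one, Matrix.cons_val_fin_one]
        linear_combination c1
      have hX0b : |X 0| ≤ ν / 4 := by
        rw [hX0, abs_neg, abs_mul, abs_of_nonneg ht1]
        calc _ ≤ 1 * (ν / 4) := mul_le_mul ht1' (abs_le.2 h1) (abs_nonneg _) zero_le_one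
          _ = _ := one_mul _
      have hX1b : |X 1| ≤ ν / 4 := by
        have h3 : |r * X 1| ≤ 1 * (r * (ν / 4)) := by
          rw [hX1, abs_neg, abs_mul, abs_of_nonneg ht1]
          exact mul_le_mul ht1' (abs_le.2 h2) (abs_nonneg _) zero_le_one
        rw [abs_mul, abs_of_pos hr, one_mul] at h3
        exact le_of_mul_le_mul_left h3 hr
      have hXn : ν ^ 2 ≤ ‖X‖ ^ 2 := pow_le_pow_left₀ hν.le (hνb φ t ht) 2
      rw [norm_sq_plane] at hXn
      have h3 := sq_le_sq' (abs_le.1 hX0b).1 (abs_le.1 hX0b).2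
      have h4 := sq_le_sq' (abs_le.1 hX1b).1 (abs_le.1 hX1b).2
      nlinarith [pow_pos hν 2]
    · rw [if_neg hMk]
      refine hasPolarDegree_displacement_zero_of_bounds hr hc hper hrot ?_
      rcases lt_or_gt_of_ne (show M ≠ k by omega) with hlt | hlt
      · left
        have : (M : ℝ) + 1 ≤ k := by exact_mod_cast hlt
        have := mul_le_mul_of_nonneg_right this Real.pi_pos.le
        linarith [Real.pi_pos]
      · right
        have : (k : ℝ) + 1 ≤ M := by exact_mod_cast hlt
        have := mul_le_mul_of_nonneg_right this Real.pi_pos.le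
        linarith [Real.pi_pos]

/-- The conclusions hold along any filter of radii for which the system is asymptotically
linear. -/
theorem IsAsymptoticallyLinearAlong.eventually_hasRotationAndDegree (hT : 0 < T)
    (hH : IsRegularHamiltonian T H) (hA : IsAsymptoticallyLinearAlong T H A l)
    (hΦ : IsFundamentalMatrix T A Φ) {i : ℤ} (hi : HasMaslovIndex T Φ i) :
    ∀ᶠ r in l, HasRotationAndDegree T H r i := by
  obtain ⟨-, Ψ, θ, hΨΦ, hc, hs, hn, -, -, hθ, hend⟩ := hi
  have h : IsProlongedPath T Ψ θ i := ⟨hc, hs, hn, hθ, hend⟩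
  rcases Int.even_or_odd' i with ⟨k, rfl | rfl⟩
  · exact eventually_hasRotationAndDegree_even hT hH hA hΦ h hΨΦ
  · exact eventually_hasRotationAndDegree_odd hT hH hA hΦ h hΨΦ

end Core

end PlanarHamiltonian

end

theorem lemma2p6 (T : ℝ) (hT : 0 < T) (H : ℝ → PlanarHamiltonian.Plane → ℝ)
    (hH : PlanarHamiltonian.IsRegularHamiltonian T H) :
    (∀ (A Ψ : ℝ → PlanarHamiltonian.Mat) (i₀ : ℤ),
      PlanarHamiltonian.IsAsymptoticallyLinearAtZero T H A →
      PlanarHamiltonian.IsFundamentalMatrix T A Ψ →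
      PlanarHamiltonian.IsNonresonant T Ψ →
      PlanarHamiltonian.HasMaslovIndex T Ψ i₀ →
      ∃ r₀ > 0, ∀ r, 0 < r → r < r₀ →
        PlanarHamiltonian.HasRotationAndDegree T H r i₀) ∧
    (∀ (B Ψ : ℝ → PlanarHamiltonian.Mat) (i₁ : ℤ),
      PlanarHamiltonian.IsAsymptoticallyLinearAtInfinity T H B →
      PlanarHamiltonian.IsFundamentalMatrix T B Ψ →
      PlanarHamiltonian.IsNonresonant T Ψ →
      PlanarHamiltonian.HasMaslovIndex T Ψ i₁ →
      ∃ r₁ > 0, ∀ r, r₁ < r →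
        PlanarHamiltonian.HasRotationAndDegree T H r i₁) := by
  refine ⟨fun A Ψ i₀ hA hΨ _ hi => ?_, fun B Ψ i₁ hB hΨ _ hi => ?_⟩
  · obtain ⟨r₀, hr₀, h⟩ := mem_nhdsGT_iff_exists_Ioo_subset.1
      (hA.along.eventually_hasRotationAndDegree hT hH hΨ hi)
    exact ⟨r₀, hr₀, fun r h0 h1 => h ⟨h0, h1⟩⟩
  · obtain ⟨a, h⟩ := Filter.eventually_atTop.1
      ((hB.along hH).eventually_hasRotationAndDegree hT hH hΨ hi)
    exact ⟨max a 1, by positivity, fun r hr => h r ((le_max_left _ _).trans hr.le)⟩
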